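/- **Setting.** A *piecewise $C^2$ graph* $\Gamma\subset\mathbb R^3$ consists of finitely many points, its vertices, and finitely many simple arcs, its edges, each joining two vertices. Each edge is of class $C^2$ up to its endpoints with respect to arc length $s$. No edge contains a vertex in its interior, and distinct edges meet only in common endpoints. Several edges may join the same two vertices. For a vertex $q$ let $T_1,\dots,T_d$ be the unit tangent vectors at $q$ pointing into the $d=d(q)$ edges that end at $q$. Let $\chi_i:S^2\to\{-1,+1\}$ be $-1$ where $\langle e,T_i\rangle>0$ and $+1$ elsewhere. Put $$\mathrm{nc}(q)=\frac14\int_{S^2}\Big[\sum_{i=1}^d\chi_i(e)\Big]^+dA_{S^2}(e),\qquad \mathcal N(\Gamma)=\sum_{q\text{ a vertex}}\mathrm{nc}(q)+\sum_{\text{edges}}\int\Big|\frac{d^2x}{ds^2}\Big|\,ds,$$ where $[t]^+=\max(t,0)$. The number $\mathcal N(\Gamma)$ is the *net total curvature* of $\Gamma$. The *double* of $\Gamma$ has the same vertices and two copies of every edge. A *parameterization* $\Gamma'$ of the double is obtained by matching in pairs, at each vertex $q$, the $2d(q)$ ends of doubled edges at $q$, and gluing the doubled edges along this matching. This gives a compact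 one-dimensional manifold without boundary, not necessarily connected, with a map to $\mathbb R^3$ that covers each edge of the double once. For $e\in S^2$ and $q\in\Gamma$ let $\mathrm{lmax}(e,q)$ and $\mathrm{lmin}(e,q)$ be the numbers of points of $\Gamma'$ over $q$ at which the height function $\langle e,\cdot\rangle$ along $\Gamma'$ has a local maximum, respectively a local minimum. The number of *net local maxima* at $q$ is $\mathrm{nlm}(e,q)=\frac12[\mathrm{lmax}(e,q)-\mathrm{lmin}(e,q)]$. The *multiplicity* at $e$ is $$\mu(e)=\sum_q[\mathrm{nlm}(e,q)]^+,$$ the sum over all $q$ that are vertices of $\Gamma$ or critical points of $\langle e,\cdot\rangle$, that is, interior points of edges at which $\langle e,dx/ds\rangle=0$. **Theorem.** Let $\Gamma$ be a piecewise $C^2$ graph in $\mathbb R^3$ and let $\Gamma'$ be any parameterization of its double. Then for almost every $e\in S^2$ the height function $\langle e,\cdot\rangle$ has only finitely many critical points on $\Gamma$, so that $\mu(e)$ is a finite sum; the function $\mu$ is integrable on $S^2$; and $$\mathcal N(\Gamma)=\frac12\int_{S^2}\mu(e)\,dA_{S^2}(e).$$ -/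

import Mathlib

open Set MeasureTheory

noncomputable section

/-- Euclidean three-space. -/
abbrev R3 : Type := EuclideanSpace ℝ (Fin 3)

/-- The unit sphere of directions. -/
abbrev S2 : Type := Metric.sphere (0 : R3) 1

/-- Surface area on the unit sphere (total mass `4 * π`). -/
def sphereArea : Measure S2 := (volume : Measure R3).toSphere

/-- A piecewise `C²` graph embedded in `ℝ³`, with vertices indexed by `V` and edges by `E`
(both assumed finite wherever it matters).  Every edge is a simple arc, of class `C²` up to its
endpoints and given by its parameterization by arc length on `[0, len a]`; its endpoints are
vertices, and distinct edges meet only in common endpoints.  Several edges may join the same two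
vertices, and the graph need not be connected.  The ends of an edge are labelled by `Bool`:
`false` is the initial end (parameter `0`), `true` the final end (parameter `len a`). -/
structure PiecewiseC2Graph (V E : Type*) where
  pos : V → R3
  pos_injective : Function.Injective pos
  endVertex : E → Bool → V
  len : E → ℝ
  len_pos : ∀ a, 0 < len a
  curve : E → ℝ → R3
  contDiffOn_curve : ∀ a, ContDiffOn ℝ 2 (curve a) (Icc 0 (len a))
  unit_speed : ∀ a, ∀ s ∈ Icc 0 (len a), ‖derivWithin (curve a) (Icc 0 (len a)) s‖ = 1
  injOn_curve : ∀ a, InjOn (curve a) (Icc 0 (len a))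
  curve_zero : ∀ a, curve a 0 = pos (endVertex a false)
  curve_len : ∀ a, curve a (len a) = pos (endVertex a true)
  interior_ne_vertex : ∀ a, ∀ s ∈ Ioo 0 (len a), ∀ v, curve a s ≠ pos v
  interior_disjoint : ∀ a b, a ≠ b → ∀ s ∈ Ioo 0 (len a), ∀ t ∈ Ioo 0 (len b),
    curve a s ≠ curve b t

namespace PiecewiseC2Graph

variable {V E : Type*} (G : PiecewiseC2Graph V E)

/-- The velocity `dx/ds` along the edge `a` (one-sided at the endpoints). -/
def velocity (a : E) (s : ℝ) : R3 := derivWithin (G.curve a) (Icc 0 (G.len a)) s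

/-- The curvature vector `d²x/ds²` along the edge `a`. -/
def curvatureVector (a : E) (s : ℝ) : R3 :=
  iteratedDerivWithin 2 (G.curve a) (Icc 0 (G.len a)) s

/-- The unit tangent vector at an end of the edge `a`, pointing into the edge. -/
def endTangent (a : E) : Bool → R3
  | false => G.velocity a 0
  | true => -G.velocity a (G.len a)

/-- The function equal to `-1` on the open hemisphere centred at `T` and to `+1` elsewhere. -/
def hemisphereSign (T : R3) (e : S2) : ℝ := if 0 < inner ℝ (e : R3) T then -1 else 1

open Classical in
/-- The contribution `nc(v)` of a vertex: a quarter of the integral over the sphere of the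
positive part of the sum of the functions `χᵢ` of the edges (edge ends) at `v`. -/
def vertexNetCurvature [Fintype E] (v : V) : ℝ :=
  (1 / 4) * ∫ e : S2,
    max (∑ h : E × Bool with G.endVertex h.1 h.2 = v,
      hemisphereSign (G.endTangent h.1 h.2) e) 0 ∂sphereArea

/-- The net total curvature: vertex contributions plus the total curvature of the open edges. -/
def netTotalCurvature [Fintype V] [Fintype E] : ℝ :=
  ∑ v : V, G.vertexNetCurvature v + ∑ a : E, ∫ s in Ioo 0 (G.len a), ‖G.curvatureVector a s‖

/-- The two edge copies in the double of the graph, as a disjoint union of closed intervals: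
a point is an edge, one of the labels of its two copies, and an arc length parameter. -/
abbrev DoubledEdges : Type _ := Σ d : E × Bool, Icc (0 : ℝ) (G.len d.1)

/-- The endpoint of a doubled edge; `((a, i), b)` is the end `b` of the copy `i` of `a`. -/
def doubledEnd : (E × Bool) × Bool → G.DoubledEdges
  | (d, false) => ⟨d, 0, left_mem_Icc.2 (G.len_pos d.1).le⟩
  | (d, true) => ⟨d, G.len d.1, right_mem_Icc.2 (G.len_pos d.1).le⟩

/-- The obvious map from the doubled edges to space. -/
def doubledMap (x : G.DoubledEdges) : R3 := G.curve x.1.1 x.2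

theorem doubledMap_doubledEnd (h : (E × Bool) × Bool) :
    G.doubledMap (G.doubledEnd h) = G.pos (G.endVertex h.1.1 h.2) := by
  rcases h with ⟨d, _ | _⟩
  · exact G.curve_zero d.1
  · exact G.curve_len d.1

/-- A parameterization of the double of the graph by a compact one-dimensional manifold (without
boundary, not necessarily connected) covering each edge of the double once.  It is described by
how the doubled edges are glued end to end: at every vertex the ends of the doubled edges are
matched in pairs.  The manifold itself is `Parameterization.Domain`. -/
structure Parameterization where
  mate : (E × Bool) × Bool → (E × Bool) × Bool
  mate_involutive : Function.Involutive mate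
  mate_ne : ∀ h, mate h ≠ h
  endVertex_mate : ∀ h, G.endVertex (mate h).1.1 (mate h).2 = G.endVertex h.1.1 h.2

/-- Parameterizations exist: run along one copy of each edge and back along the other one. -/
instance : Nonempty G.Parameterization :=
  ⟨{ mate := fun h => ((h.1.1, !h.1.2), h.2)
     mate_involutive := fun h => by simp
     mate_ne := fun h hh => by
       have := congrArg (fun k => k.1.2) hh
       simp at this
     endVertex_mate := fun _ => rfl }⟩

namespace Parameterization

variable {G} (P : G.Parameterization)

/-- Each end of a doubled edge is glued to its mate. -/
def Glue (x y : G.DoubledEdges) : Prop :=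
  ∃ h, x = G.doubledEnd h ∧ y = G.doubledEnd (P.mate h)

/-- The parameterizing closed one-dimensional manifold, with the quotient topology. -/
def Domain : Type _ := Quot P.Glue

instance : TopologicalSpace P.Domain := inferInstanceAs (TopologicalSpace (Quot P.Glue))

/-- The parameterization itself, as a map into space. -/
def toSpace : P.Domain → R3 :=
  Quot.lift G.doubledMap (by
    rintro x y ⟨h, rfl, rfl⟩
    rw [doubledMap_doubledEnd, doubledMap_doubledEnd, P.endVertex_mate])

/-- The height function `⟨e, ·⟩` along the parameterization. -/
def height (e : S2) (x : P.Domain) : ℝ := inner ℝ (e : R3) (P.toSpace x)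

/-- The number of local maxima of the height at the points over `q`. -/
def lmax (e : S2) (q : R3) : ℕ := {x | P.toSpace x = q ∧ IsLocalMax (P.height e) x}.ncard

/-- The number of local minima of the height at the points over `q`. -/
def lmin (e : S2) (q : R3) : ℕ := {x | P.toSpace x = q ∧ IsLocalMin (P.height e) x}.ncard

/-- The number of net local maxima of the height at `q`, a half-integer. -/
def nlm (e : S2) (q : R3) : ℝ := (1 / 2) * ((P.lmax e q : ℝ) - (P.lmin e q : ℝ))

end Parameterization

/-- The points over which the multiplicity is summed: the vertices, and the critical points of
`⟨e, ·⟩` in the interiors of the edges. -/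
def criticalPoints (e : S2) : Set R3 :=
  range G.pos ∪
    {q | ∃ a, ∃ s ∈ Ioo 0 (G.len a), G.curve a s = q ∧ inner ℝ (e : R3) (G.velocity a s) = 0}

variable {G} in
/-- The multiplicity `μ(e)`.  It is the intended sum when there are finitely many vertices and
critical points, and arbitrary otherwise. -/
def Parameterization.multiplicity (P : G.Parameterization) (e : S2) : ℝ :=
  ∑ᶠ q ∈ G.criticalPoints e, max (P.nlm e q) 0

end PiecewiseC2Graph

end

/-!
For a generic direction `e`, the tangents at the ends of the edges are not orthogonal to `e` and
the critical points of the height along the edges are nondegenerate. A point of the parameterizing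
manifold over a vertex is then a local maximum, a local minimum or neither according to the signs of
`⟨e, T⟩` at the two ends glued there, so it contributes the mean of the two corresponding `χᵢ` to
`lmax - lmin`. Hence `nlm e v` is half the sum of the `χᵢ` at `v`, however the ends are matched.
Over a critical point inside an edge there are two local maxima or two local minima. Therefore
`μ(e)` is the sum of the positive parts `½ [∑ χᵢ]⁺` over the vertices, plus, for every edge, the
number of times at which its unit tangent `T` crosses the great circle orthogonal to `e` downwards.

The integral of the vertex terms is `2 nc` by definition, and the integral of the number of
crossings is twice the length of the curve `T` in the sphere. For the latter (Crofton's formula),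
`T` is replaced by inscribed geodesic polygons: the directions for which a crossing occurs between
two consecutive vertices form a lune, whose area is proportional to their angle.
-/

noncomputable section

open Filter Topology

section Sphere

open Metric Module
open scoped Pointwise

variable {F : Type*} [NormedAddCommGroup F] [NormedSpace ℝ F] [MeasurableSpace F] [BorelSpace F]

theorem toSphere_preimage_cone (μ : Measure F) {C : Set F} (hC : MeasurableSet C)
    (hcone : ∀ r : ℝ, 0 < r → ∀ x, r • x ∈ C ↔ x ∈ C) :
    μ.toSphere ((↑) ⁻¹' C) = finrank ℝ F * μ (C ∩ (ball 0 1 \ {0})) := by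
  have hpolar : Ioo (0 : ℝ) 1 • sphere (0 : F) 1 = ball 0 1 \ {0} := by
    simpa using Ioo_smul_sphere_zero (E := F) (b := 1) le_rfl one_pos
  rw [μ.toSphere_apply' (hC.preimage measurable_subtype_coe), ← hpolar]
  congr 2
  ext x
  constructor
  · rintro ⟨r, hr, _, ⟨e, he, rfl⟩, rfl⟩
    exact ⟨(hcone r hr.1 e).2 he, smul_mem_smul hr e.2⟩
  · rintro ⟨hx, r, hr, e, he, rfl⟩
    exact smul_mem_smul hr ⟨⟨e, he⟩, (hcone r hr.1 e).1 hx, rfl⟩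

theorem ae_toSphere_of_ae {μ : Measure F} {p : F → Prop} (hp : MeasurableSet {x | p x})
    (hcone : ∀ r : ℝ, 0 < r → ∀ x, p (r • x) ↔ p x) (h : ∀ᵐ x ∂μ, p x) :
    ∀ᵐ e : sphere (0 : F) 1 ∂μ.toSphere, p e := by
  have hnull := toSphere_preimage_cone μ hp.compl fun r hr x => not_congr (hcone r hr x)
  rwa [measure_mono_null inter_subset_left h, mul_zero] at hnull

end Sphere

section Sector

open Real

theorem volume_inter_ball_eq_mul_lintegral_of_mem_iff_arg {A : Set ℂ} {S : Set ℝ}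
    (hA : MeasurableSet A) (hS : MeasurableSet S) (hAS : ∀ z ≠ 0, z ∈ A ↔ z.arg ∈ S) (r : ℝ) :
    volume (A ∩ Metric.ball 0 r) =
      volume (S ∩ Ioo (-π) π) * ∫⁻ ρ in Ioo 0 r, ENNReal.ofReal ρ := by
  have hpolar : ∀ p ∈ polarCoord.target, ENNReal.ofReal p.1 • (A ∩ Metric.ball 0 r).indicator 1
      (Complex.polarCoord.symm p) =
      (Iio r).indicator ENNReal.ofReal p.1 * S.indicator 1 p.2 := by
    rintro ⟨ρ, φ⟩ ⟨hρ : 0 < ρ, hφ⟩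
    have hnorm : ‖Complex.polarCoord.symm (ρ, φ)‖ = ρ := by
      rw [Complex.norm_polarCoord_symm, abs_of_pos hρ]
    have hmem : Complex.polarCoord.symm (ρ, φ) ∈ A ↔ φ ∈ S := by
      rw [hAS _ (norm_pos_iff.1 (hnorm.symm ▸ hρ)), Complex.polarCoord_symm_apply]
      push_cast
      rw [Complex.arg_mul_cos_add_sin_mul_I hρ (Ioo_subset_Ioc_self hφ)]
    by_cases h1 : ρ < r <;> by_cases h2 : φ ∈ S <;>
      simp [indicator, hmem, hnorm, h1, h2, -Complex.polarCoord_symm_apply]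
  rw [← lintegral_indicator_one (hA.inter measurableSet_ball),
    ← Complex.lintegral_comp_polarCoord_symm,
    setLIntegral_congr_fun polarCoord.open_target.measurableSet hpolar, polarCoord_target,
    Measure.volume_eq_prod, ← Measure.prod_restrict, lintegral_prod_mul
      (ENNReal.measurable_ofReal.indicator measurableSet_Iio).aemeasurable
      (measurable_one.indicator hS).aemeasurable, lintegral_indicator_one hS,
    setLIntegral_indicator measurableSet_Iio, Measure.restrict_apply hS, mul_comm,
    inter_comm (Iio r), Ioi_inter_Iio]

theorem volume_inter_ball_eq_mul_volume_ball_of_mem_iff_arg {A : Set ℂ} {S : Set ℝ}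
    (hA : MeasurableSet A) (hS : MeasurableSet S) (hAS : ∀ z ≠ 0, z ∈ A ↔ z.arg ∈ S) (r : ℝ) :
    volume (A ∩ Metric.ball 0 r) =
      volume (S ∩ Ioo (-π) π) / ENNReal.ofReal (2 * π) * volume (Metric.ball (0 : ℂ) r) := by
  have hball := volume_inter_ball_eq_mul_lintegral_of_mem_iff_arg (A := univ) .univ .univ
    (by simp) r
  rw [univ_inter, univ_inter, Real.volume_Ioo, sub_neg_eq_add, ← two_mul] at hball
  rw [volume_inter_ball_eq_mul_lintegral_of_mem_iff_arg hA hS hAS, hball, ← mul_assoc,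
    ENNReal.div_mul_cancel]
  · simp [pi_pos]
  · exact ENNReal.ofReal_ne_top

variable {F : Type*} [NormedAddCommGroup F] [InnerProductSpace ℝ F] [FiniteDimensional ℝ F]

/-- The orthogonal projection of `x` to the plane `K`, read as a complex number through the
orthonormal basis `b` of `K`. It makes the planar polar coordinates available for
sectors in `F` bounded by two half-hyperplanes whose edge is `Kᗮ`. -/
def planeCoord {K : Submodule ℝ F} (b : OrthonormalBasis (Fin 2) ℝ K) (x : F) : ℂ :=
  (Complex.isometryOfOrthonormal b).symm (K.orthogonalProjectionOnto x)

theorem norm_sq_planeCoord_add_norm_sq_orthogonal {K : Submodule ℝ F}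
    (b : OrthonormalBasis (Fin 2) ℝ K) (x : F) :
    ‖planeCoord b x‖ ^ 2 + ‖Kᗮ.orthogonalProjectionOnto x‖ ^ 2 = ‖x‖ ^ 2 := by
  rw [planeCoord, LinearIsometryEquiv.norm_map, ← K.norm_sq_eq_add_norm_sq_projection]

theorem re_planeCoord {K : Submodule ℝ F} (b : OrthonormalBasis (Fin 2) ℝ K) (x : F) :
    (planeCoord b x).re = inner ℝ x (b 0 : F) := by
  simp [planeCoord, Complex.isometryOfOrthonormal_symm_apply, b.repr_apply_apply,
    real_inner_comm]

theorem im_planeCoord {K : Submodule ℝ F} (b : OrthonormalBasis (Fin 2) ℝ K) (x : F) :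
    (planeCoord b x).im = inner ℝ x (b 1 : F) := by
  simp [planeCoord, Complex.isometryOfOrthonormal_symm_apply, b.repr_apply_apply,
    real_inner_comm]

variable [MeasurableSpace F] [BorelSpace F]

theorem measurePreserving_planeCoord_prod {K : Submodule ℝ F} (b : OrthonormalBasis (Fin 2) ℝ K) :
    MeasurePreserving (fun x : F => (planeCoord b x, Kᗮ.orthogonalProjectionOnto x)) volume
      (volume.prod volume) := by
  have hcoord : (fun x : F => (planeCoord b x, Kᗮ.orthogonalProjectionOnto x)) =
      Prod.map (Complex.isometryOfOrthonormal b).symm id ∘ WithLp.ofLp ∘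
        K.orthogonalDecomposition := by
    ext x : 1
    simp [planeCoord]
  rw [hcoord]
  exact ((Complex.isometryOfOrthonormal b).symm.measurePreserving.prod (.id volume)).comp
    ((WithLp.volume_preserving_ofLp K Kᗮ).comp K.orthogonalDecomposition.measurePreserving)

theorem volume_planeCoord_preimage_inter_ball {K : Submodule ℝ F}
    (b : OrthonormalBasis (Fin 2) ℝ K) {A : Set ℂ} (hA : MeasurableSet A) :
    volume (planeCoord b ⁻¹' A ∩ Metric.ball 0 1) =
      ∫⁻ y : Kᗮ, volume (A ∩ Metric.ball 0 √(1 - ‖y‖ ^ 2)) := by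
  let B : Set (ℂ × Kᗮ) := {p | p.1 ∈ A ∧ ‖p.1‖ ^ 2 + ‖p.2‖ ^ 2 < 1}
  have hB : MeasurableSet B := (measurable_fst hA).inter
    (isOpen_lt (f := fun p : ℂ × Kᗮ => ‖p.1‖ ^ 2 + ‖p.2‖ ^ 2) (by fun_prop)
      continuous_const).measurableSet
  have hpre : planeCoord b ⁻¹' A ∩ Metric.ball 0 1 =
      (fun x : F => (planeCoord b x, Kᗮ.orthogonalProjectionOnto x)) ⁻¹' B := by
    ext x
    simp only [B, mem_inter_iff, mem_preimage, mem_ball_zero_iff, mem_ofPred_eq,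
      norm_sq_planeCoord_add_norm_sq_orthogonal, sq_lt_one_iff₀ (norm_nonneg _)]
  rw [hpre, (measurePreserving_planeCoord_prod b).measure_preimage hB.nullMeasurableSet,
    Measure.prod_apply_symm hB]
  congr!
  ext z
  simp [B, Real.lt_sqrt (norm_nonneg z), lt_sub_iff_add_lt]

theorem volume_planeCoord_preimage_inter_ball_of_mem_iff_arg {K : Submodule ℝ F}
    (b : OrthonormalBasis (Fin 2) ℝ K) {A : Set ℂ} {S : Set ℝ} (hA : MeasurableSet A)
    (hS : MeasurableSet S) (hAS : ∀ z ≠ 0, z ∈ A ↔ z.arg ∈ S) :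
    volume (planeCoord b ⁻¹' A ∩ Metric.ball 0 1) =
      volume (S ∩ Ioo (-π) π) / ENNReal.ofReal (2 * π) * volume (Metric.ball (0 : F) 1) := by
  have hball := volume_planeCoord_preimage_inter_ball b .univ
  simp only [preimage_univ, univ_inter] at hball
  rw [volume_planeCoord_preimage_inter_ball b hA, hball, ← lintegral_const_mul]
  · simp_rw [volume_inter_ball_eq_mul_volume_ball_of_mem_iff_arg hA hS hAS]
  · simp_rw [Complex.volume_ball]
    fun_prop

end Sector

section Lune

open Real InnerProductGeometry Module

theorem re_pos_and_cos_mul_re_add_sin_mul_im_neg_iff {θ : ℝ} (hθ : θ ∈ Icc 0 π) {z : ℂ}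
    (hz : z ≠ 0) :
    (0 < z.re ∧ cos θ * z.re + sin θ * z.im < 0) ↔ z.arg ∈ Ioo (-(π / 2)) (θ - π / 2) := by
  have hcos : cos θ * z.re + sin θ * z.im = ‖z‖ * cos (θ - z.arg) := by
    rw [cos_sub, mul_add, mul_left_comm, mul_left_comm ‖z‖, Complex.norm_mul_cos_arg,
      Complex.norm_mul_sin_arg]
  have hre : 0 < z.re ↔ |z.arg| < π / 2 := by simp [Complex.abs_arg_lt_pi_div_two_iff, hz]
  rw [hcos, hre, abs_lt, ← smul_eq_mul, smul_neg_iff_of_pos_left (norm_pos_iff.2 hz)]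
  constructor
  · rintro ⟨harg, hneg⟩
    refine ⟨harg.1, ?_⟩
    by_contra! hle
    exact hneg.not_ge (cos_nonneg_of_mem_Icc ⟨by linarith [harg.2, hθ.1], by linarith⟩)
  · rintro ⟨hlo, hhi⟩
    exact ⟨⟨hlo, by linarith [hθ.2]⟩,
      cos_neg_of_pi_div_two_lt_of_lt (by linarith) (by linarith [hθ.2])⟩

variable {F : Type*} [NormedAddCommGroup F] [InnerProductSpace ℝ F]

theorem exists_norm_eq_one_eq_norm_smul [Nontrivial F] (z : F) :
    ∃ w : F, ‖w‖ = 1 ∧ z = ‖z‖ • w := by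
  rcases eq_or_ne z 0 with rfl | hz
  · obtain ⟨w, hw⟩ := exists_norm_eq F zero_le_one
    exact ⟨w, hw, by simp⟩
  · exact ⟨‖z‖⁻¹ • z, norm_smul_inv_norm hz, (smul_inv_smul₀ (norm_ne_zero_iff.2 hz) z).symm⟩

theorem exists_norm_eq_one_eq_cos_smul_add_sin_smul [FiniteDimensional ℝ F]
    (hF : 2 ≤ finrank ℝ F) {u v : F} (hu : ‖u‖ = 1) (hv : ‖v‖ = 1) :
    ∃ w, ‖w‖ = 1 ∧ inner ℝ u w = 0 ∧ v = cos (angle u v) • u + sin (angle u v) • w := by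
  have hcos : cos (angle u v) = inner ℝ u v := by simp [cos_angle, hu, hv]
  have : Nontrivial (ℝ ∙ u)ᗮ := by
    apply Module.nontrivial_of_finrank_pos (R := ℝ)
    have hspan := (ℝ ∙ u).finrank_add_finrank_orthogonal
    rw [finrank_span_singleton (norm_ne_zero_iff.1 (hu ▸ one_ne_zero))] at hspan
    omega
  let z : F := v - cos (angle u v) • u
  have hz : z ∈ (ℝ ∙ u)ᗮ := by
    simp [z, Submodule.mem_orthogonal_singleton_iff_inner_right, inner_sub_right, inner_smul_right,
      hcos, hu]
  have hnorm : ‖z‖ = sin (angle u v) := by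
    rw [← sq_eq_sq₀ (norm_nonneg z) (sin_angle_nonneg u v), sin_sq, norm_sub_sq_real, norm_smul,
      inner_smul_right, hcos, real_inner_comm, hu, hv, norm_eq_abs, mul_pow, sq_abs]
    ring
  obtain ⟨w, hw, hzw⟩ := exists_norm_eq_one_eq_norm_smul (⟨z, hz⟩ : (ℝ ∙ u)ᗮ)
  refine ⟨w, hw, Submodule.mem_orthogonal_singleton_iff_inner_right.1 w.2, ?_⟩
  rw [← hnorm, ← sub_eq_iff_eq_add']
  exact congrArg Subtype.val hzw

theorem exists_orthonormalBasis_eq_pair {u w : F} (hu : ‖u‖ = 1) (hw : ‖w‖ = 1)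
    (huw : inner ℝ u w = 0) :
    ∃ (K : Submodule ℝ F) (b : OrthonormalBasis (Fin 2) ℝ K), (b 0 : F) = u ∧ (b 1 : F) = w := by
  have hon : Orthonormal ℝ ![u, w] := by simp [hu, hw, huw]
  have hspan : Orthonormal ℝ (Basis.span hon.linearIndependent) := by
    rw [funext (Basis.span_apply hon.linearIndependent)]
    exact orthonormal_span hon
  refine ⟨_, (Basis.span hon.linearIndependent).toOrthonormalBasis hspan, ?_, ?_⟩ <;>
    simp [Basis.span_apply]

theorem toSphere_lune [FiniteDimensional ℝ F] [MeasurableSpace F] [BorelSpace F]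
    (hF : 2 ≤ finrank ℝ F) {u v : F} (hu : ‖u‖ = 1) (hv : ‖v‖ = 1) :
    (volume : Measure F).toSphere {e | 0 < inner ℝ (e : F) u ∧ inner ℝ (e : F) v < 0} =
      ENNReal.ofReal (angle u v) / ENNReal.ofReal (2 * π) *
        (volume : Measure F).toSphere univ := by
  have hθ : angle u v ∈ Icc 0 π := ⟨angle_nonneg u v, angle_le_pi u v⟩
  obtain ⟨w, hw, huw, hvw⟩ := exists_norm_eq_one_eq_cos_smul_add_sin_smul hF hu hv
  obtain ⟨K, b, hb0, hb1⟩ := exists_orthonormalBasis_eq_pair hu hw huw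
  let A : Set ℂ := {z | 0 < z.re} ∩ {z | cos (angle u v) * z.re + sin (angle u v) * z.im < 0}
  let C : Set F := {x | 0 < inner ℝ x u} ∩ {x | inner ℝ x v < 0}
  have hA : MeasurableSet A := by
    refine (measurableSet_lt ?_ ?_).inter (measurableSet_lt ?_ ?_) <;> fun_prop
  have hC : MeasurableSet C := by
    refine (measurableSet_lt ?_ ?_).inter (measurableSet_lt ?_ ?_) <;> fun_prop
  have hAC : planeCoord b ⁻¹' A = C := by
    ext x
    have hxv : inner ℝ x v = cos (angle u v) * inner ℝ x u + sin (angle u v) * inner ℝ x w := by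
      conv_lhs => rw [hvw, inner_add_right, inner_smul_right, inner_smul_right]
    simp only [A, C, mem_preimage, mem_inter_iff, mem_ofPred_eq, re_planeCoord, im_planeCoord,
      hb0, hb1, hxv]
  have hcone : ∀ r : ℝ, 0 < r → ∀ x, r • x ∈ C ↔ x ∈ C := by
    intro r hr x
    simp [C, inner_smul_left, hr, mul_neg_iff, hr.not_gt]
  have hzero : (0 : F) ∉ C ∩ Metric.ball 0 1 := by simp [C]
  calc _ = finrank ℝ F * volume (C ∩ Metric.ball 0 1) := by
        rw [← sdiff_singleton_eq_self hzero, inter_sdiff_assoc, ← toSphere_preimage_cone _ hC hcone]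
        rfl
    _ = _ := by
        rw [← hAC, volume_planeCoord_preimage_inter_ball_of_mem_iff_arg b hA measurableSet_Ioo
          fun z hz => re_pos_and_cos_mul_re_add_sin_mul_im_neg_iff hθ hz,
          Measure.toSphere_apply_univ, inter_eq_left.2
            (Ioo_subset_Ioo (by linarith [pi_pos]) (by linarith [hθ.2, pi_pos])),
          Real.volume_Ioo, mul_left_comm, sub_neg_eq_add, sub_add_cancel]

end Lune

section GenericZeros

variable {F : Type*} [NormedAddCommGroup F] [InnerProductSpace ℝ F]

theorem volume_image_eq_zero_of_hasDerivWithinAt_zero {g : ℝ → ℝ} {s : Set ℝ}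
    (hg : ∀ x ∈ s, HasDerivWithinAt g 0 s x) : volume (g '' s) = 0 :=
  addHaar_image_eq_zero_of_det_fderivWithin_eq_zero volume
    (fun x hx => (hg x hx).hasFDerivWithinAt) (by simp [ContinuousLinearMap.det])

theorem ae_forall_inner_add_smul_eq_zero_imp_ne_zero {T T' : ℝ → F} {K : Set ℝ}
    (hT : ∀ s ∈ K, HasDerivWithinAt T (T' s) K s) {u : F} (hu : ∀ s ∈ K, inner ℝ u (T s) ≠ 0)
    (y : F) :
    ∀ᵐ t : ℝ, ∀ s ∈ K, inner ℝ (y + t • u) (T s) = 0 → inner ℝ (y + t • u) (T' s) ≠ 0 := by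
  -- `y + t • u` is orthogonal to `T s` iff `t = g s`, and then also to `T' s` iff `s` is critical
  -- for `g`; almost every `t` is a regular value by Sard's theorem.
  let g : ℝ → ℝ := fun s => -(inner ℝ y (T s) / inner ℝ u (T s))
  let Z : Set ℝ := {s ∈ K | HasDerivWithinAt g 0 K s}
  have hZ : volume (g '' Z) = 0 :=
    volume_image_eq_zero_of_hasDerivWithinAt_zero fun s hs => hs.2.mono (sep_subset _ _)
  filter_upwards [compl_mem_ae_iff.2 hZ] with t ht s hs hzero hzero'
  simp only [inner_add_left, real_inner_smul_left] at hzero hzero'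
  have hgs : g s = t := by
    simp only [g]
    field_simp [hu s hs]
    linarith
  refine ht ⟨s, ⟨hs, ?_⟩, hgs⟩
  have hinner : ∀ w : F,
      HasDerivWithinAt (fun s => inner ℝ w (T s)) (inner ℝ w (T' s)) K s := fun w =>
    by simpa using (hasDerivWithinAt_const s K w).inner ℝ (hT s hs)
  have hderiv : -((inner ℝ y (T' s) * inner ℝ u (T s) - inner ℝ y (T s) * inner ℝ u (T' s)) /
      inner ℝ u (T s) ^ 2) = 0 := by
    rw [neg_eq_zero, div_eq_zero_iff]
    exact .inl (by linear_combination inner ℝ u (T s) * hzero' - inner ℝ u (T' s) * hzero)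
  exact hderiv ▸ ((hinner y).div (hinner u) (hu s hs)).neg

theorem isClosed_setOf_exists_inner_eq_zero {T T' : ℝ → F} {K : Set ℝ} (hK : IsCompact K)
    (hT : ContinuousOn T K) (hT' : ContinuousOn T' K) :
    IsClosed {y : F | ∃ s ∈ K, inner ℝ y (T s) = 0 ∧ inner ℝ y (T' s) = 0} := by
  have := isCompact_iff_compactSpace.1 hK
  have hTK : Continuous fun s : K => T s := continuousOn_iff_continuous_domRestrict.1 hT
  have hTK' : Continuous fun s : K => T' s := continuousOn_iff_continuous_domRestrict.1 hT'
  have hclosed : IsClosed {p : K × F | inner ℝ p.2 (T p.1) = 0 ∧ inner ℝ p.2 (T' p.1) = 0} :=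
    (isClosed_eq (continuous_snd.inner (hTK.comp continuous_fst)) continuous_const).inter
      (isClosed_eq (continuous_snd.inner (hTK'.comp continuous_fst)) continuous_const)
  convert isClosedMap_snd_of_compactSpace _ hclosed
  ext y
  simp [and_left_comm]

variable [FiniteDimensional ℝ F] [MeasurableSpace F] [BorelSpace F]

theorem ae_forall_inner_eq_zero_imp_ne_zero_of_inner_ne_zero (μ : Measure F)
    [μ.IsAddHaarMeasure] {T T' : ℝ → F} {K : Set ℝ} (hK : IsCompact K)
    (hT : ∀ s ∈ K, HasDerivWithinAt T (T' s) K s) (hT' : ContinuousOn T' K) {u : F}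
    (hu : ∀ s ∈ K, inner ℝ u (T s) ≠ 0) :
    ∀ᵐ y ∂μ, ∀ s ∈ K, inner ℝ y (T s) = 0 → inner ℝ y (T' s) ≠ 0 := by
  have hmeas := (isClosed_setOf_exists_inner_eq_zero hK
    (fun s hs => (hT s hs).continuousWithinAt) hT').measurableSet.compl
  have hae := ae_mem_of_ae_add_linearMap_mem (LinearMap.toSpanSingleton ℝ F u) volume μ hmeas
    fun y => by simpa using! ae_forall_inner_add_smul_eq_zero_imp_ne_zero hT hu y
  simpa using! hae

theorem ae_forall_inner_eq_zero_imp_ne_zero (μ : Measure F) [μ.IsAddHaarMeasure] {T T' : ℝ → F}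
    {K : Set ℝ} (hK : IsCompact K) (hT : ∀ s ∈ K, HasDerivWithinAt T (T' s) K s)
    (hT' : ContinuousOn T' K) (hne : ∀ s ∈ K, T s ≠ 0) :
    ∀ᵐ y ∂μ, ∀ s ∈ K, inner ℝ y (T s) = 0 → inner ℝ y (T' s) ≠ 0 := by
  refine hK.induction_on (p := fun S => ∀ᵐ y ∂μ, ∀ s ∈ S, inner ℝ y (T s) = 0 →
    inner ℝ y (T' s) ≠ 0) (by simp) (fun S S' hSS' h => h.mono fun y hy s hs => hy s (hSS' hs))
    (fun S S' hS hS' => ?_) fun r hr => ?_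
  · filter_upwards [hS, hS'] with y hy hy' s hs
    exact hs.elim (hy s) (hy' s)
  · have hcont : ContinuousWithinAt (fun s => inner ℝ (T r) (T s)) K r :=
      continuousWithinAt_const.inner (hT r hr).continuousWithinAt
    obtain ⟨ε, hε, hball⟩ := (nhdsWithin_hasBasis Metric.nhds_basis_closedBall K).mem_iff.1
      (hcont.eventually_ne (inner_self_ne_zero.2 (hne r hr)))
    refine ⟨_, inter_mem (mem_nhdsWithin_of_mem_nhds (Metric.closedBall_mem_nhds r hε))
      self_mem_nhdsWithin, ?_⟩
    exact ae_forall_inner_eq_zero_imp_ne_zero_of_inner_ne_zero μ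
      (hK.inter_left Metric.isClosed_closedBall)
      (fun s hs => (hT s hs.2).mono inter_subset_right) (hT'.mono inter_subset_right) hball

theorem ae_inner_ne_zero (μ : Measure F) [μ.IsAddHaarMeasure] {u : F} (hu : u ≠ 0) :
    ∀ᵐ y ∂μ, inner ℝ y u ≠ 0 := by
  filter_upwards [ae_forall_inner_eq_zero_imp_ne_zero μ (T := fun _ => u) (T' := 0)
    (isCompact_singleton (x := 0)) (fun s _ => hasDerivWithinAt_const s _ u)
    continuousOn_const fun _ _ => hu] with y hy h0
  simpa [h0] using hy 0

end GenericZeros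

section UniformPartition

/-- The `i`-th node of the partition of `[a, b]` into `n` intervals of equal length. -/
def uniformNode (a b : ℝ) (n i : ℕ) : ℝ := a + i * ((b - a) / n)

variable {a b : ℝ} {n i : ℕ}

theorem uniformNode_zero : uniformNode a b n 0 = a := by simp [uniformNode]

theorem uniformNode_self (hn : n ≠ 0) : uniformNode a b n n = b := by
  have : (n : ℝ) ≠ 0 := by exact_mod_cast hn
  rw [uniformNode, mul_div_cancel₀ _ this, add_sub_cancel]

theorem uniformNode_succ_sub : uniformNode a b n (i + 1) - uniformNode a b n i = (b - a) / n := by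
  simp only [uniformNode, Nat.cast_add, Nat.cast_one]
  ring

theorem monotone_uniformNode (hab : a ≤ b) : Monotone (uniformNode a b n) :=
  monotone_nat_of_le_succ fun i => sub_nonneg.1 <|
    uniformNode_succ_sub (i := i) ▸ div_nonneg (sub_nonneg.2 hab) n.cast_nonneg

theorem uniformNode_mem_Icc (hab : a ≤ b) (hn : n ≠ 0) (hi : i ≤ n) :
    uniformNode a b n i ∈ Icc a b :=
  ⟨uniformNode_zero.symm.trans_le (monotone_uniformNode hab i.zero_le),
    (monotone_uniformNode hab hi).trans_eq (uniformNode_self hn)⟩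

theorem Icc_uniformNode_subset (hab : a ≤ b) (hn : n ≠ 0) (hi : i < n) :
    Icc (uniformNode a b n i) (uniformNode a b n (i + 1)) ⊆ Icc a b :=
  Icc_subset_Icc (uniformNode_mem_Icc hab hn hi.le).1 (uniformNode_mem_Icc hab hn hi).2

theorem sum_integral_uniformNode (hab : a ≤ b) (hn : n ≠ 0) {f : ℝ → ℝ}
    (hf : ContinuousOn f (Icc a b)) :
    ∑ i ∈ Finset.range n, ∫ s in uniformNode a b n i..uniformNode a b n (i + 1), f s =
      ∫ s in a..b, f s := by
  rw [intervalIntegral.sum_integral_adjacent_intervals fun i hi =>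
    (hf.mono (Icc_uniformNode_subset hab hn hi)).intervalIntegrable_of_Icc
      (monotone_uniformNode hab i.le_succ), uniformNode_zero, uniformNode_self hn]

end UniformPartition

section Chords

variable {F : Type*} [NormedAddCommGroup F] [NormedSpace ℝ F] {T T' : ℝ → F} {a b : ℝ}

theorem abs_norm_sub_sub_integral_norm_le (hab : a ≤ b)
    (hT : ∀ s ∈ Icc a b, HasDerivWithinAt T (T' s) (Icc a b) s) (hT' : ContinuousOn T' (Icc a b))
    {c : F} {ε : ℝ} (hc : ∀ s ∈ Icc a b, ‖T' s - c‖ ≤ ε) :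
    |‖T b - T a‖ - ∫ s in a..b, ‖T' s‖| ≤ 2 * ε * (b - a) := by
  have hchord : ‖(T b - T a) - (b - a) • c‖ ≤ ε * (b - a) := by
    have h := (convex_Icc a b).norm_image_sub_le_of_norm_hasDerivWithin_le
      (f := fun s => T s - s • c) (f' := fun s => T' s - c)
      (fun s hs => by
        simpa using (hT s hs).fun_sub ((hasDerivWithinAt_id s _).smul_const c)) hc
      (left_mem_Icc.2 hab) (right_mem_Icc.2 hab)
    rw [Real.norm_of_nonneg (sub_nonneg.2 hab)] at h
    convert h using 2
    module
  have hint : |(∫ s in a..b, ‖T' s‖) - ‖(b - a) • c‖| ≤ ε * (b - a) := by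
    have hconst : ‖(b - a) • c‖ = ∫ _ in a..b, ‖c‖ := by
      rw [intervalIntegral.integral_const, norm_smul, Real.norm_of_nonneg (sub_nonneg.2 hab),
        smul_eq_mul]
    rw [hconst, ← intervalIntegral.integral_sub (hT'.norm.intervalIntegrable_of_Icc hab)
      (by simp), ← abs_of_nonneg (sub_nonneg.2 hab), ← Real.norm_eq_abs]
    refine intervalIntegral.norm_integral_le_of_norm_le_const fun s hs => ?_
    rw [uIoc_of_le hab] at hs
    exact (abs_norm_sub_norm_le _ _).trans (hc s (Ioc_subset_Icc_self hs))
  calc _ ≤ |‖T b - T a‖ - ‖(b - a) • c‖| + |‖(b - a) • c‖ - ∫ s in a..b, ‖T' s‖| :=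
        abs_sub_le _ _ _
    _ ≤ ε * (b - a) + ε * (b - a) :=
        add_le_add ((abs_norm_sub_norm_le _ _).trans hchord) (abs_sub_comm ‖(b - a) • c‖ _ ▸ hint)
    _ = 2 * ε * (b - a) := by ring

theorem tendsto_sum_norm_sub_uniformNode (hab : a ≤ b)
    (hT : ∀ s ∈ Icc a b, HasDerivWithinAt T (T' s) (Icc a b) s)
    (hT' : ContinuousOn T' (Icc a b)) :
    Tendsto (fun n : ℕ => ∑ i ∈ Finset.range n,
      ‖T (uniformNode a b n (i + 1)) - T (uniformNode a b n i)‖) atTop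
      (𝓝 (∫ s in a..b, ‖T' s‖)) := by
  rw [Metric.tendsto_nhds]
  intro ε hε
  let η : ℝ := ε / (2 * (b - a) + 1)
  have hη : 0 < η := div_pos hε (by linarith)
  obtain ⟨δ, hδ, hunif⟩ := Metric.uniformContinuousOn_iff_le.1
    (isCompact_Icc.uniformContinuousOn_of_continuous hT') η hη
  have hmesh := (tendsto_const_div_atTop_nhds_zero_nat (b - a)).eventually_le_const hδ
  filter_upwards [hmesh, eventually_ne_atTop 0] with n hn hn0
  have hpiece : ∀ i ∈ Finset.range n,
      |‖T (uniformNode a b n (i + 1)) - T (uniformNode a b n i)‖ -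
        ∫ s in uniformNode a b n i..uniformNode a b n (i + 1), ‖T' s‖| ≤
      2 * η * ((b - a) / n) := by
    intro i hi
    have hsub := Icc_uniformNode_subset hab hn0 (Finset.mem_range.1 hi)
    have hle := monotone_uniformNode (n := n) hab i.le_succ
    rw [← uniformNode_succ_sub (i := i)]
    refine abs_norm_sub_sub_integral_norm_le (c := T' (uniformNode a b n i)) hle
      (fun s hs => (hT s (hsub hs)).mono hsub) (hT'.mono hsub) fun s hs => ?_
    rw [← dist_eq_norm]
    refine hunif s (hsub hs) _ (hsub (left_mem_Icc.2 hle)) ?_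
    rw [Real.dist_eq, abs_of_nonneg (sub_nonneg.2 hs.1)]
    exact ((sub_le_sub_right hs.2 _).trans_eq uniformNode_succ_sub).trans hn
  rw [Real.dist_eq, ← sum_integral_uniformNode hab hn0 hT'.norm, ← Finset.sum_sub_distrib]
  calc _ ≤ ∑ i ∈ Finset.range n, 2 * η * ((b - a) / n) :=
        (Finset.abs_sum_le_sum_abs _ _).trans (Finset.sum_le_sum hpiece)
    _ = η * (2 * (b - a)) := by
        rw [Finset.sum_const, Finset.card_range, nsmul_eq_mul]
        field_simp
    _ < η * (2 * (b - a) + 1) := by gcongr; linarith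
    _ = ε := div_mul_cancel₀ _ (by linarith)

theorem tendsto_sum_norm_sub_pow_three_uniformNode (hab : a ≤ b)
    (hT : ∀ s ∈ Icc a b, HasDerivWithinAt T (T' s) (Icc a b) s)
    (hT' : ContinuousOn T' (Icc a b)) :
    Tendsto (fun n : ℕ => ∑ i ∈ Finset.range n,
      ‖T (uniformNode a b n (i + 1)) - T (uniformNode a b n i)‖ ^ 3) atTop (𝓝 0) := by
  obtain ⟨M, hM⟩ := isCompact_Icc.exists_bound_of_continuousOn hT'
  have hM0 : 0 ≤ M * (b - a) := mul_nonneg ((norm_nonneg _).trans (hM a (left_mem_Icc.2 hab)))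
    (sub_nonneg.2 hab)
  have hchord : ∀ n ≠ 0, ∀ i ∈ Finset.range n,
      ‖T (uniformNode a b n (i + 1)) - T (uniformNode a b n i)‖ ≤ M * (b - a) / n := by
    intro n hn i hi
    have hle := monotone_uniformNode (n := n) hab i.le_succ
    have hi := Finset.mem_range.1 hi
    have h := (convex_Icc a b).norm_image_sub_le_of_norm_hasDerivWithin_le hT hM
      (uniformNode_mem_Icc hab hn hi.le) (uniformNode_mem_Icc hab hn hi)
    rwa [Real.norm_of_nonneg (sub_nonneg.2 hle), uniformNode_succ_sub, ← mul_div_assoc] at h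
  refine squeeze_zero' (.of_forall fun n => by positivity) ?_
    (tendsto_const_div_atTop_nhds_zero_nat ((M * (b - a)) ^ 3))
  filter_upwards [eventually_ne_atTop 0] with n hn
  calc _ ≤ ∑ _i ∈ Finset.range n, (M * (b - a) / n) ^ 3 := Finset.sum_le_sum fun i hi =>
        pow_le_pow_left₀ (norm_nonneg _) (hchord n hn i hi) 3
    _ = (M * (b - a)) ^ 3 / n / n := by
        rw [Finset.sum_const, Finset.card_range, nsmul_eq_mul]
        field_simp
    _ ≤ (M * (b - a)) ^ 3 / n :=
        div_le_self (div_nonneg (pow_nonneg hM0 3) n.cast_nonneg)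
          (by exact_mod_cast Nat.one_le_iff_ne_zero.2 hn)

end Chords

section Angles

open InnerProductGeometry Real

variable {F : Type*} [NormedAddCommGroup F] [InnerProductSpace ℝ F]

theorem norm_sub_eq_two_mul_sin_half_angle {u v : F} (hu : ‖u‖ = 1) (hv : ‖v‖ = 1) :
    ‖u - v‖ = 2 * sin (angle u v / 2) := by
  have hsin : 0 ≤ sin (angle u v / 2) := sin_nonneg_of_nonneg_of_le_pi
    (by linarith [angle_nonneg u v]) (by linarith [angle_le_pi u v, pi_pos])
  have hcos : inner ℝ u v = cos (angle u v) := by simp [cos_angle, hu, hv]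
  rw [← sq_eq_sq₀ (norm_nonneg _) (by positivity), norm_sub_sq_real, hu, hv, hcos, mul_pow,
    sin_sq_eq_half_sub, mul_div_cancel₀ _ two_ne_zero]
  ring

theorem norm_sub_le_angle {u v : F} (hu : ‖u‖ = 1) (hv : ‖v‖ = 1) : ‖u - v‖ ≤ angle u v := by
  rw [norm_sub_eq_two_mul_sin_half_angle hu hv]
  linarith [sin_le (x := angle u v / 2) (by linarith [angle_nonneg u v])]

theorem angle_le_norm_sub_add_pow_three {u v : F} (hu : ‖u‖ = 1) (hv : ‖v‖ = 1) :
    angle u v ≤ ‖u - v‖ + ‖u - v‖ ^ 3 := by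
  set x := angle u v / 2 with hx
  have hchord : ‖u - v‖ = 2 * sin x := norm_sub_eq_two_mul_sin_half_angle hu hv
  have hx0 : 0 ≤ x := by linarith [angle_nonneg u v]
  have hjordan : 2 / π * x ≤ sin x := mul_le_sin hx0 (by linarith [angle_le_pi u v])
  have hle : x ≤ ‖u - v‖ := by
    have hhalf : x / 2 ≤ 2 / π * x := by
      rw [div_mul_eq_mul_div, div_le_div_iff₀ two_pos pi_pos]
      nlinarith [pi_le_four]
    linarith
  linarith [sin_ge_sub_cube hx0, pow_le_pow_left₀ hx0 hle 3, pow_nonneg hx0 3]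

theorem tendsto_sum_angle_uniformNode {T T' : ℝ → F} {a b : ℝ} (hab : a ≤ b)
    (hT : ∀ s ∈ Icc a b, HasDerivWithinAt T (T' s) (Icc a b) s)
    (hT' : ContinuousOn T' (Icc a b)) (hunit : ∀ s ∈ Icc a b, ‖T s‖ = 1) :
    Tendsto (fun n : ℕ => ∑ i ∈ Finset.range n,
      angle (T (uniformNode a b n i)) (T (uniformNode a b n (i + 1)))) atTop
      (𝓝 (∫ s in a..b, ‖T' s‖)) := by
  have hchord := tendsto_sum_norm_sub_uniformNode hab hT hT'
  have hcube := tendsto_sum_norm_sub_pow_three_uniformNode hab hT hT'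
  simp only [norm_sub_rev (T (uniformNode a b _ (_ + 1)))] at hchord hcube
  have hnodes : ∀ n ≠ 0, ∀ i ∈ Finset.range n, ‖T (uniformNode a b n i)‖ = 1 ∧
      ‖T (uniformNode a b n (i + 1))‖ = 1 := fun n hn i hi =>
    ⟨hunit _ (uniformNode_mem_Icc hab hn (Finset.mem_range.1 hi).le),
      hunit _ (uniformNode_mem_Icc hab hn (Finset.mem_range.1 hi))⟩
  refine tendsto_of_tendsto_of_tendsto_of_le_of_le' hchord (add_zero (∫ s in a..b, ‖T' s‖) ▸
    hchord.add hcube) ?_ ?_ <;>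
    filter_upwards [eventually_ne_atTop 0] with n hn
  · exact Finset.sum_le_sum fun i hi => norm_sub_le_angle (hnodes n hn i hi).1 (hnodes n hn i hi).2
  · rw [← Finset.sum_add_distrib]
    exact Finset.sum_le_sum fun i hi =>
      angle_le_norm_sub_add_pow_three (hnodes n hn i hi).1 (hnodes n hn i hi).2

end Angles

section Descents

variable {f f' : ℝ → ℝ} {a b : ℝ}

theorem finite_setOf_eq_zero_of_hasDerivWithinAt {K : Set ℝ} (hK : IsCompact K)
    (hf : ∀ s ∈ K, HasDerivWithinAt f (f' s) K s) (hsimple : ∀ s ∈ K, f s = 0 → f' s ≠ 0) :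
    {s ∈ K | f s = 0}.Finite := by
  by_contra hinf
  have hcont : ContinuousOn f K := fun s hs => (hf s hs).continuousWithinAt
  have hclosed : IsClosed {s ∈ K | f s = 0} :=
    hcont.preimage_isClosed_of_isClosed hK.isClosed isClosed_singleton
  obtain ⟨x, hx, hacc⟩ := Set.Infinite.exists_accPt_of_subset_isCompact hinf hK fun s hs => hs.1
  have hfx : f x = 0 := (hclosed.closure_subset hacc.clusterPt.mem_closure).2
  have hne : ∀ᶠ y in 𝓝[K \ {x}] x, f y ≠ 0 := (hf x hx).eventually_ne (hsimple x hx hfx)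
  rw [accPt_iff_frequently] at hacc
  exact hacc ((eventually_nhdsWithin_iff.1 hne).mono fun y hy h => hy ⟨h.2.1, h.1⟩ h.2.2)

theorem exists_hasDerivWithinAt_neg_of_pos_of_neg (hab : a ≤ b)
    (hf : ∀ s ∈ Icc a b, HasDerivWithinAt f (f' s) (Icc a b) s)
    (hsimple : ∀ s ∈ Icc a b, f s = 0 → f' s ≠ 0) (hfa : 0 < f a) (hfb : f b < 0) :
    ∃ z ∈ Ioo a b, f z = 0 ∧ f' z < 0 := by
  have hcont : ContinuousOn f (Icc a b) := fun s hs => (hf s hs).continuousWithinAt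
  have hcompact : IsCompact (Icc a b ∩ f ⁻¹' Ici 0) := isCompact_Icc.of_isClosed_subset
    (hcont.preimage_isClosed_of_isClosed isClosed_Icc isClosed_Ici) inter_subset_left
  obtain ⟨z, ⟨hz, hfz⟩, hmax⟩ := hcompact.exists_isGreatest ⟨a, left_mem_Icc.2 hab, hfa.le⟩
  have hzb : z < b := hz.2.lt_of_ne (by rintro rfl; exact hfb.not_ge hfz)
  have hneg : ∃ᶠ x in 𝓝[Icc a b] z, z < x ∧ f x < 0 := by
    have hle : 𝓝[>] z ≤ 𝓝[Icc a b] z := nhdsWithin_Ioo_eq_nhdsGT hzb ▸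
      nhdsWithin_mono z (Ioo_subset_Icc_self.trans (Icc_subset_Icc_left hz.1))
    refine Frequently.filter_mono (Eventually.frequently ?_) hle
    filter_upwards [Ioo_mem_nhdsGT hzb] with x hx
    exact ⟨hx.1, not_le.1 fun h => hx.1.not_ge (hmax ⟨⟨hz.1.trans hx.1.le, hx.2.le⟩, h⟩)⟩
  have hfz0 : f z = 0 := le_antisymm (not_lt.1 fun hpos =>
    hneg (((hcont z hz).eventually_const_lt hpos).mono fun x hx h => hx.not_gt h.2)) hfz
  have hza : a < z := hz.1.lt_of_ne (by rintro rfl; exact hfa.ne' hfz0)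
  have hderiv : HasDerivAt f (f' z) z := (hf z hz).hasDerivAt (Icc_mem_nhds hza hzb)
  refine ⟨z, ⟨hza, hzb⟩, hfz0, (hsimple z hz hfz0).lt_of_le (not_lt.1 fun hpos => hneg ?_)⟩
  have hsign := eventually_nhdsWithin_sign_eq_of_deriv_pos (hderiv.deriv.symm ▸ hpos) hfz0
  filter_upwards [nhdsWithin_le_nhds hsign] with x hx h
  rw [sign_neg h.2, sign_pos (sub_pos.2 h.1)] at hx
  contradiction

/-- The zeros of `f` in `(a, b)` at which the derivative `f'` is negative: there `f` passes from
positive to negative values. -/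
def descents (f f' : ℝ → ℝ) (a b : ℝ) : Set ℝ := {s ∈ Ioo a b | f s = 0 ∧ f' s < 0}

/-- The number of intervals of the uniform partition of `[a, b]` into `n` parts over which `f`
passes from positive to negative values, a lower approximation to the number of `descents`. -/
def downCrossings (f : ℝ → ℝ) (a b : ℝ) (n : ℕ) : ℕ :=
  {i ∈ Finset.range n | 0 < f (uniformNode a b n i) ∧ f (uniformNode a b n (i + 1)) < 0}.card

theorem finite_descents (hf : ∀ s ∈ Icc a b, HasDerivWithinAt f (f' s) (Icc a b) s)
    (hsimple : ∀ s ∈ Icc a b, f s = 0 → f' s ≠ 0) : (descents f f' a b).Finite :=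
  (finite_setOf_eq_zero_of_hasDerivWithinAt isCompact_Icc hf hsimple).subset
    fun _ h => ⟨Ioo_subset_Icc_self h.1, h.2.1⟩

theorem eq_of_mem_Ioo_uniformNode (hab : a ≤ b) {n i j : ℕ} {z : ℝ}
    (hi : z ∈ Ioo (uniformNode a b n i) (uniformNode a b n (i + 1)))
    (hj : z ∈ Ioo (uniformNode a b n j) (uniformNode a b n (j + 1))) : i = j :=
  (monotone_uniformNode hab).pairwise_disjoint_on_Ioo_succ.eq
    (not_disjoint_iff.2 ⟨z, hi, hj⟩)

theorem exists_mem_Ioo_uniformNode (hab : a ≤ b) {n : ℕ} (hn : n ≠ 0) {z : ℝ} (hz : z ∈ Ioo a b)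
    (hnode : ∀ i ≤ n, uniformNode a b n i ≠ z) :
    ∃ i < n, z ∈ Ioo (uniformNode a b n i) (uniformNode a b n (i + 1)) := by
  have hcover := (monotone_uniformNode (n := n) hab).biUnion_Ico_Ioc_map_succ 0 n
  rw [uniformNode_zero, uniformNode_self hn] at hcover
  obtain ⟨i, hi, hzi⟩ := mem_iUnion₂.1 (hcover.symm ▸ Ioo_subset_Ioc_self hz)
  exact ⟨i, hi.2, hzi.1, hzi.2.lt_of_ne (hnode _ hi.2).symm⟩

theorem downCrossings_le_ncard_descents (hab : a ≤ b)
    (hf : ∀ s ∈ Icc a b, HasDerivWithinAt f (f' s) (Icc a b) s)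
    (hsimple : ∀ s ∈ Icc a b, f s = 0 → f' s ≠ 0) (n : ℕ) :
    downCrossings f a b n ≤ (descents f f' a b).ncard := by
  rw [ncard_eq_toFinset_card _ (finite_descents hf hsimple)]
  refine Finset.card_le_card_of_forall_subsingleton
    (fun i z => z ∈ Ioo (uniformNode a b n i) (uniformNode a b n (i + 1))) ?_
    fun z _ i hi j hj => eq_of_mem_Ioo_uniformNode hab hi.2 hj.2
  intro i hi
  obtain ⟨hin, hpos, hneg⟩ := Finset.mem_filter.1 hi
  have hin := Finset.mem_range.1 hin
  have hsub := Icc_uniformNode_subset hab (Nat.ne_zero_of_lt hin) hin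
  have hle := monotone_uniformNode (n := n) hab i.le_succ
  obtain ⟨z, hz, hz'⟩ := exists_hasDerivWithinAt_neg_of_pos_of_neg hle
    (fun s hs => (hf s (hsub hs)).mono hsub) (fun s hs => hsimple s (hsub hs)) hpos hneg
  exact ⟨z, (Finite.mem_toFinset _).2 ⟨Ioo_subset_Ioo (hsub (left_mem_Icc.2 hle)).1
    (hsub (right_mem_Icc.2 hle)).2 hz, hz'⟩, hz⟩

theorem exists_pos_forall_mem_descents_sign_eq
    (hf : ∀ s ∈ Icc a b, HasDerivWithinAt f (f' s) (Icc a b) s)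
    (hsimple : ∀ s ∈ Icc a b, f s = 0 → f' s ≠ 0) :
    ∃ ε > 0, ∀ z ∈ descents f f' a b, ∀ x, |x - z| < ε →
      SignType.sign (f x) = SignType.sign (z - x) := by
  have hsmall : ∀ᶠ ε in 𝓝[>] (0 : ℝ), ∀ z ∈ descents f f' a b, ∀ x, |x - z| < ε →
      SignType.sign (f x) = SignType.sign (z - x) := by
    refine (eventually_all_finite (finite_descents hf hsimple)).2 fun z hz => ?_
    have hderiv := (hf z (Ioo_subset_Icc_self hz.1)).hasDerivAt (Icc_mem_nhds hz.1.1 hz.1.2)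
    obtain ⟨δ, hδ, h⟩ := Metric.eventually_nhds_iff.1
      (eventually_nhdsWithin_sign_eq_of_deriv_neg (hderiv.deriv.symm ▸ hz.2.2) hz.2.1)
    filter_upwards [Ioo_mem_nhdsGT hδ] with ε hε x hx using h (hx.trans hε.2)
  obtain ⟨ε, h, hε⟩ := (hsmall.and self_mem_nhdsWithin).exists
  exact ⟨ε, hε, h⟩

theorem ncard_descents_le_downCrossings (hab : a ≤ b)
    (hf : ∀ s ∈ Icc a b, HasDerivWithinAt f (f' s) (Icc a b) s)
    (hsimple : ∀ s ∈ Icc a b, f s = 0 → f' s ≠ 0) {n : ℕ} (hn : n ≠ 0) {ε : ℝ}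
    (hsign : ∀ z ∈ descents f f' a b, ∀ x, |x - z| < ε →
      SignType.sign (f x) = SignType.sign (z - x))
    (hmesh : (b - a) / n < ε) (hnode : ∀ i ≤ n, f (uniformNode a b n i) ≠ 0) :
    (descents f f' a b).ncard ≤ downCrossings f a b n := by
  have hclose {i : ℕ} {x y : ℝ}
      (hx : x ∈ Icc (uniformNode a b n i) (uniformNode a b n (i + 1)))
      (hy : y ∈ Icc (uniformNode a b n i) (uniformNode a b n (i + 1))) : |x - y| < ε :=
    (abs_sub_le_of_le_of_le hx.1 hx.2 hy.1 hy.2).trans_lt (uniformNode_succ_sub.trans_lt hmesh)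
  rw [ncard_eq_toFinset_card _ (finite_descents hf hsimple)]
  refine Finset.card_le_card_of_forall_subsingleton
    (fun z i => z ∈ Ioo (uniformNode a b n i) (uniformNode a b n (i + 1))) ?_ ?_
  · intro z hz
    have hz := (Finite.mem_toFinset _).1 hz
    obtain ⟨i, hi, hzi⟩ := exists_mem_Ioo_uniformNode hab hn hz.1 fun i hi h =>
      hnode i hi (h ▸ hz.2.1)
    have hle := hzi.1.le.trans hzi.2.le
    have hzi' := Ioo_subset_Icc_self hzi
    have hleft := hsign z hz _ (hclose (left_mem_Icc.2 hle) hzi')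
    have hright := hsign z hz _ (hclose (right_mem_Icc.2 hle) hzi')
    rw [sign_pos (sub_pos.2 hzi.1), sign_eq_one_iff] at hleft
    rw [sign_neg (sub_neg.2 hzi.2), sign_eq_neg_one_iff] at hright
    exact ⟨i, Finset.mem_filter.2 ⟨Finset.mem_range.2 hi, hleft, hright⟩, hzi⟩
  · rintro i - z ⟨hz, hzi⟩ w ⟨hw, hwi⟩
    have h := hsign z ((Finite.mem_toFinset _).1 hz) w
      (hclose (Ioo_subset_Icc_self hwi) (Ioo_subset_Icc_self hzi))
    rw [((Finite.mem_toFinset _).1 hw).2.1, sign_zero, eq_comm, sign_eq_zero_iff] at h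
    exact sub_eq_zero.1 h

theorem eventually_downCrossings_eq_ncard_descents (hab : a ≤ b)
    (hf : ∀ s ∈ Icc a b, HasDerivWithinAt f (f' s) (Icc a b) s)
    (hsimple : ∀ s ∈ Icc a b, f s = 0 → f' s ≠ 0)
    (hnode : ∀ n ≠ 0, ∀ i ≤ n, f (uniformNode a b n i) ≠ 0) :
    ∀ᶠ n in atTop, downCrossings f a b n = (descents f f' a b).ncard := by
  obtain ⟨ε, hε, hsign⟩ := exists_pos_forall_mem_descents_sign_eq hf hsimple
  filter_upwards [(tendsto_const_div_atTop_nhds_zero_nat (b - a)).eventually_lt_const hε,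
    eventually_ne_atTop 0] with n hmesh hn
  exact (downCrossings_le_ncard_descents hab hf hsimple n).antisymm
    (ncard_descents_le_downCrossings hab hf hsimple hn hsign hmesh (hnode n hn))

end Descents

section Crofton

open Module InnerProductGeometry

variable {F : Type*} [NormedAddCommGroup F] [InnerProductSpace ℝ F] {T T' : ℝ → F} {a b : ℝ}

theorem hasDerivWithinAt_inner_const {D : Set ℝ} {d : F} {s : ℝ} (hT : HasDerivWithinAt T d D s)
    (e : F) : HasDerivWithinAt (fun s => inner ℝ e (T s)) (inner ℝ e d) D s := by
  simpa using (hasDerivWithinAt_const s D e).inner ℝ hT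

/-- The times in `(a, b)` at which the curve `T` with derivative `T'` passes through the hyperplane
orthogonal to `e` from the side of `e` to the other one. -/
def hyperplaneDescents (T T' : ℝ → F) (a b : ℝ) (e : F) : Set ℝ :=
  descents (fun s => inner ℝ e (T s)) (fun s => inner ℝ e (T' s)) a b

theorem downCrossings_inner_eq_sum_indicator (T : ℝ → F) (a b : ℝ) (n : ℕ)
    (e : Metric.sphere (0 : F) 1) :
    (downCrossings (fun s => inner ℝ (e : F) (T s)) a b n : ENNReal) =
      ∑ i ∈ Finset.range n, {e : Metric.sphere (0 : F) 1 |
        0 < inner ℝ (e : F) (T (uniformNode a b n i)) ∧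
          inner ℝ (e : F) (T (uniformNode a b n (i + 1))) < 0}.indicator 1 e := by
  rw [downCrossings, Finset.card_filter]
  push_cast
  exact Finset.sum_congr rfl fun i _ => by simp [indicator]

variable [MeasurableSpace F] [BorelSpace F]

theorem ae_toSphere_forall_inner_eq_zero_imp_ne_zero [FiniteDimensional ℝ F] {K : Set ℝ}
    (hK : IsCompact K) (hT : ∀ s ∈ K, HasDerivWithinAt T (T' s) K s) (hT' : ContinuousOn T' K)
    (hne : ∀ s ∈ K, T s ≠ 0) :
    ∀ᵐ e : Metric.sphere (0 : F) 1 ∂volume.toSphere, ∀ s ∈ K, inner ℝ (e : F) (T s) = 0 →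
      inner ℝ (e : F) (T' s) ≠ 0 := by
  have hmeas := (isClosed_setOf_exists_inner_eq_zero hK
    (fun s hs => (hT s hs).continuousWithinAt) hT').measurableSet.compl
  refine ae_toSphere_of_ae (by simpa [compl_ofPred] using! hmeas) (fun r hr x => ?_)
    (ae_forall_inner_eq_zero_imp_ne_zero volume hK hT hT' hne)
  simp [inner_smul_left, hr.ne']

theorem ae_toSphere_inner_ne_zero [FiniteDimensional ℝ F] {u : F} (hu : u ≠ 0) :
    ∀ᵐ e : Metric.sphere (0 : F) 1 ∂volume.toSphere, inner ℝ (e : F) u ≠ 0 :=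
  ae_toSphere_of_ae (measurableSet_eq_fun (by fun_prop) (by fun_prop)).compl
    (fun r hr x => by simp [inner_smul_left, hr.ne']) (ae_inner_ne_zero volume hu)

theorem measurableSet_sphere_lune (u v : F) : MeasurableSet
    {e : Metric.sphere (0 : F) 1 | 0 < inner ℝ (e : F) u ∧ inner ℝ (e : F) v < 0} :=
  (isOpen_lt (f := fun _ : Metric.sphere (0 : F) 1 => (0 : ℝ)) (by fun_prop)
    (by fun_prop)).measurableSet.inter
    (isOpen_lt (g := fun _ : Metric.sphere (0 : F) 1 => (0 : ℝ)) (by fun_prop)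
      (by fun_prop)).measurableSet

theorem measurable_downCrossings_inner (T : ℝ → F) (a b : ℝ) (n : ℕ) :
    Measurable fun e : Metric.sphere (0 : F) 1 =>
      (downCrossings (fun s => inner ℝ (e : F) (T s)) a b n : ENNReal) := by
  simp only [downCrossings_inner_eq_sum_indicator]
  exact Finset.measurable_sum _ fun i _ =>
    measurable_one.indicator (measurableSet_sphere_lune _ _)

variable [FiniteDimensional ℝ F]

theorem lintegral_downCrossings_inner (hF : 2 ≤ finrank ℝ F) (hab : a ≤ b)
    (hunit : ∀ s ∈ Icc a b, ‖T s‖ = 1) {n : ℕ} (hn : n ≠ 0) :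
    ∫⁻ e : Metric.sphere (0 : F) 1, downCrossings (fun s => inner ℝ (e : F) (T s)) a b n
        ∂volume.toSphere =
      ENNReal.ofReal (∑ i ∈ Finset.range n,
        angle (T (uniformNode a b n i)) (T (uniformNode a b n (i + 1)))) /
        ENNReal.ofReal (2 * Real.pi) * (volume : Measure F).toSphere univ := by
  simp only [downCrossings_inner_eq_sum_indicator]
  rw [lintegral_finsetSum _ fun i _ => measurable_one.indicator (measurableSet_sphere_lune _ _),
    ENNReal.ofReal_sum_of_nonneg fun i _ => angle_nonneg _ _, ENNReal.div_eq_inv_mul,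
    Finset.mul_sum, Finset.sum_mul]
  refine Finset.sum_congr rfl fun i hi => ?_
  have hi := Finset.mem_range.1 hi
  rw [lintegral_indicator_one (measurableSet_sphere_lune _ _), toSphere_lune hF
    (hunit _ (uniformNode_mem_Icc hab hn hi.le)) (hunit _ (uniformNode_mem_Icc hab hn hi)),
    ENNReal.div_eq_inv_mul]

variable (hab : a ≤ b) (hT : ∀ s ∈ Icc a b, HasDerivWithinAt T (T' s) (Icc a b) s)
  (hT' : ContinuousOn T' (Icc a b)) (hunit : ∀ s ∈ Icc a b, ‖T s‖ = 1)
include hab hT hT' hunit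

theorem tendsto_lintegral_downCrossings_inner (hF : 2 ≤ finrank ℝ F) :
    Tendsto (fun n => ∫⁻ e : Metric.sphere (0 : F) 1,
      downCrossings (fun s => inner ℝ (e : F) (T s)) a b n ∂volume.toSphere) atTop
      (𝓝 (ENNReal.ofReal (∫ s in a..b, ‖T' s‖) / ENNReal.ofReal (2 * Real.pi) *
        (volume : Measure F).toSphere univ)) := by
  have hangle := ENNReal.tendsto_ofReal (tendsto_sum_angle_uniformNode hab hT hT' hunit)
  refine (ENNReal.Tendsto.mul_const (ENNReal.Tendsto.div_const hangle (.inr ?_))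
    (.inr (measure_ne_top _ _))).congr' ?_
  · exact (ENNReal.ofReal_pos.2 Real.two_pi_pos).ne'
  · filter_upwards [eventually_ne_atTop 0] with n hn
    exact (lintegral_downCrossings_inner hF hab hunit hn).symm

theorem ae_eventually_downCrossings_inner_eq :
    ∀ᵐ e : Metric.sphere (0 : F) 1 ∂volume.toSphere, ∀ᶠ n in atTop,
      downCrossings (fun s => inner ℝ (e : F) (T s)) a b n =
        (hyperplaneDescents T T' a b e).ncard := by
  have hne : ∀ s ∈ Icc a b, T s ≠ 0 := fun s hs => norm_ne_zero_iff.1 (hunit s hs ▸ one_ne_zero)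
  have hnode : ∀ᵐ e : Metric.sphere (0 : F) 1 ∂volume.toSphere, ∀ n ≠ 0, ∀ i ≤ n,
      inner ℝ (e : F) (T (uniformNode a b n i)) ≠ 0 := by
    simp only [ae_all_iff]
    exact fun n hn i hi => ae_toSphere_inner_ne_zero (hne _ (uniformNode_mem_Icc hab hn hi))
  filter_upwards [ae_toSphere_forall_inner_eq_zero_imp_ne_zero isCompact_Icc hT hT' hne, hnode]
    with e hsimple he
  exact eventually_downCrossings_eq_ncard_descents hab
    (fun s hs => hasDerivWithinAt_inner_const (hT s hs) e) hsimple he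

theorem aemeasurable_ncard_hyperplaneDescents :
    AEMeasurable (fun e : Metric.sphere (0 : F) 1 =>
      ((hyperplaneDescents T T' a b e).ncard : ENNReal)) volume.toSphere := by
  refine aemeasurable_of_tendsto_metrizable_ae atTop
    (fun n => (measurable_downCrossings_inner T a b n).aemeasurable) ?_
  filter_upwards [ae_eventually_downCrossings_inner_eq hab hT hT' hunit] with e he
  exact tendsto_const_nhds.congr' (he.mono fun n hn => congrArg _ hn.symm)

theorem lintegral_ncard_hyperplaneDescents (hF : 2 ≤ finrank ℝ F) :
    ∫⁻ e : Metric.sphere (0 : F) 1, (hyperplaneDescents T T' a b e).ncard ∂volume.toSphere =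
      ENNReal.ofReal (∫ s in a..b, ‖T' s‖) / ENNReal.ofReal (2 * Real.pi) *
        (volume : Measure F).toSphere univ := by
  have hlim := tendsto_lintegral_downCrossings_inner hab hT hT' hunit hF
  have hne : ∀ s ∈ Icc a b, T s ≠ 0 := fun s hs => norm_ne_zero_iff.1 (hunit s hs ▸ one_ne_zero)
  -- The crossings eventually count all the descents, which gives `≤` by Fatou's lemma, and they
  -- never exceed the descents, which gives `≥`.
  refine le_antisymm ?_ (le_of_tendsto' hlim fun n => lintegral_mono_ae ?_)
  · rw [← hlim.liminf_eq]
    refine (lintegral_congr_ae ?_).trans_le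
      (lintegral_liminf_le fun n => measurable_downCrossings_inner T a b n)
    filter_upwards [ae_eventually_downCrossings_inner_eq hab hT hT' hunit] with e he
    exact (tendsto_const_nhds.congr' (he.mono fun n hn => congrArg _ hn.symm)).liminf_eq.symm
  · filter_upwards [ae_toSphere_forall_inner_eq_zero_imp_ne_zero isCompact_Icc hT hT' hne]
      with e hsimple
    exact_mod_cast downCrossings_le_ncard_descents hab
      (fun s hs => hasDerivWithinAt_inner_const (hT s hs) e) hsimple n

theorem integrable_ncard_hyperplaneDescents (hF : 2 ≤ finrank ℝ F) :
    Integrable (fun e : Metric.sphere (0 : F) 1 => ((hyperplaneDescents T T' a b e).ncard : ℝ))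
      volume.toSphere := by
  refine (integrable_toReal_of_lintegral_ne_top
    (aemeasurable_ncard_hyperplaneDescents hab hT hT' hunit) ?_).congr (.of_forall fun e => by simp)
  rw [lintegral_ncard_hyperplaneDescents hab hT hT' hunit hF]
  exact ENNReal.mul_ne_top (ENNReal.div_ne_top ENNReal.ofReal_ne_top
    (ENNReal.ofReal_pos.2 Real.two_pi_pos).ne') (measure_ne_top _ _)

theorem integral_ncard_hyperplaneDescents (hF : 2 ≤ finrank ℝ F) :
    ∫ e : Metric.sphere (0 : F) 1, ((hyperplaneDescents T T' a b e).ncard : ℝ) ∂volume.toSphere =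
      (∫ s in a..b, ‖T' s‖) / (2 * Real.pi) * (volume : Measure F).toSphere.real univ := by
  have h := integral_toReal (aemeasurable_ncard_hyperplaneDescents hab hT hT' hunit)
    (.of_forall fun e => ENNReal.natCast_lt_top _)
  rw [lintegral_ncard_hyperplaneDescents hab hT hT' hunit hF, ENNReal.toReal_mul,
    ENNReal.toReal_div, ENNReal.toReal_ofReal Real.two_pi_pos.le, ENNReal.toReal_ofReal
      (intervalIntegral.integral_nonneg hab fun s _ => norm_nonneg _)] at h
  simpa only [ENNReal.toReal_natCast, measureReal_def] using h

end Crofton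

section LocalExtrema

variable {g f : ℝ → ℝ} {D : Set ℝ} {s d : ℝ}

theorem hasDerivWithinAt_eq_zero_of_isLocalMaxOn_of_isLocalMinOn (hD : UniqueDiffWithinAt ℝ D s)
    (hg : HasDerivWithinAt g d D s) (hmax : IsLocalMaxOn g D s) (hmin : IsLocalMinOn g D s) :
    d = 0 := by
  have hconst : g =ᶠ[𝓝[D] s] fun _ => g s := EventuallyLE.antisymm hmax hmin
  exact hD.eq_deriv D hg ((hasDerivWithinAt_const s D (g s)).congr_of_eventuallyEq hconst rfl)

/-- `σ` is the sign of a one-sided neighbourhood `D` of `s`, so that `σ * d` is the derivative of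
`g` in the direction into `D`. -/
theorem isLocalMaxOn_of_mul_neg {σ : ℝ} (hσ : ∀ t ∈ D, 0 ≤ σ * (t - s))
    (hg : HasDerivWithinAt g d D s) (hd : σ * d < 0) : IsLocalMaxOn g D s := by
  have hslope : ∀ᶠ t in 𝓝[D \ {s}] s, σ * slope g s t < 0 :=
    ((hasDerivWithinAt_iff_tendsto_slope.1 hg).const_mul σ).eventually_lt_const hd
  rw [sdiff_eq, nhdsWithin_inter', eventually_inf_principal] at hslope
  filter_upwards [hslope, self_mem_nhdsWithin] with t ht htD
  obtain rfl | hts := eq_or_ne t s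
  · exact le_rfl
  have hmul : σ ^ 2 * (g t - g s) ≤ 0 := by
    calc σ ^ 2 * (g t - g s) = σ * slope g s t * (σ * (t - s)) := by
          rw [← vsub_eq_sub (g t), ← sub_smul_slope g s t, smul_eq_mul]; ring
      _ ≤ 0 := mul_nonpos_of_nonpos_of_nonneg (ht hts).le (hσ t htD)
  have hσ0 : 0 < σ ^ 2 := sq_pos_of_ne_zero (left_ne_zero_of_mul hd.ne)
  exact sub_nonpos.1 (nonpos_of_mul_nonpos_right hmul hσ0)

theorem isLocalMaxOn_iff_mul_neg {σ : ℝ} (hD : UniqueDiffWithinAt ℝ D s)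
    (hσ : ∀ t ∈ D, 0 ≤ σ * (t - s)) (hg : HasDerivWithinAt g d D s) (hd : σ * d ≠ 0) :
    IsLocalMaxOn g D s ↔ σ * d < 0 := by
  refine ⟨fun hmax => hd.lt_of_le (not_lt.1 fun hpos => right_ne_zero_of_mul hd ?_),
    isLocalMaxOn_of_mul_neg hσ hg⟩
  have hmin := (isLocalMaxOn_of_mul_neg hσ hg.fun_neg (by simpa using hpos)).neg
  simp only [neg_neg] at hmin
  exact hasDerivWithinAt_eq_zero_of_isLocalMaxOn_of_isLocalMinOn hD hg hmax hmin

theorem isLocalMax_iff_hasDerivAt_neg (hg : ∀ᶠ t in 𝓝 s, HasDerivAt g (f t) t)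
    (hf : HasDerivAt f d s) (hfs : f s = 0) (hd : d ≠ 0) : IsLocalMax g s ↔ d < 0 := by
  have hderiv : deriv g =ᶠ[𝓝 s] f := hg.mono fun t ht => ht.deriv
  have hderiv2 : deriv (deriv g) s = d := hderiv.deriv_eq.trans hf.deriv
  have hcrit : deriv g s = 0 := hderiv.self_of_nhds.trans hfs
  have hcont : ContinuousAt g s := hg.self_of_nhds.continuousAt
  refine ⟨fun hmax => hd.lt_of_le (not_lt.1 fun hpos => hd ?_),
    fun hneg => isLocalMax_of_deriv_deriv_neg (hderiv2 ▸ hneg) hcrit hcont⟩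
  have hmin := isLocalMin_of_deriv_deriv_pos (hderiv2 ▸ hpos) hcrit hcont
  have hconst : g =ᶠ[𝓝 s] fun _ => g s := EventuallyLE.antisymm hmax hmin
  rw [← hderiv2, hconst.deriv.deriv_eq]
  simp

end LocalExtrema

section FiniteIdentification

variable {α β : Type*}

theorem isClosedMap_of_isQuotientMap_of_finite [TopologicalSpace α] [T1Space α]
    [TopologicalSpace β] {f : α → β} (hf : IsQuotientMap f) {S : Set α} (hS : S.Finite)
    (h : ∀ x y, f x = f y → x = y ∨ y ∈ S) : IsClosedMap f := by
  intro C hC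
  rw [← hf.isClosed_preimage]
  have hsat : f ⁻¹' (f '' C) = C ∪ f ⁻¹' (f '' C) ∩ S := by
    refine subset_antisymm ?_ (union_subset (subset_preimage_image f C) inter_subset_left)
    rintro y ⟨x, hx, hxy⟩
    rcases h x y hxy with rfl | hy
    · exact .inl hx
    · exact .inr ⟨⟨x, hx, hxy⟩, hy⟩
  rw [hsat]
  exact hC.union (hS.subset inter_subset_right).isClosed

theorem isLocalMax_iff_forall_isLocalMax_comp {γ : Type*} [Preorder γ] [TopologicalSpace α]
    [TopologicalSpace β] {f : α → β} (hcont : Continuous f) (hclosed : IsClosedMap f)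
    (hsurj : Function.Surjective f) {φ : β → γ} {y : β} :
    IsLocalMax φ y ↔ ∀ x, f x = y → IsLocalMax (φ ∘ f) x := by
  refine ⟨fun h x hx => (hx ▸ h).comp_continuous hcont.continuousAt, fun h => ?_⟩
  have hev : ∀ᶠ z in 𝓝 y, ∀ x ∈ f ⁻¹' {z}, φ (f x) ≤ φ y :=
    hclosed.eventually_nhds_fiber y fun x hx => (h x hx).mono fun w hw =>
      hw.trans_eq (congrArg φ hx)
  refine hev.mono fun z hz => ?_
  obtain ⟨w, rfl⟩ := hsurj z
  exact hz w rfl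

theorem card_eq_two_mul_card_image_of_involutive [DecidableEq β] {H : Finset α} {F : α → β}
    {m : α → α} (hne : ∀ h ∈ H, m h ≠ h) (hmem : ∀ h ∈ H, m h ∈ H)
    (hF : ∀ h ∈ H, ∀ k ∈ H, F k = F h ↔ k = h ∨ k = m h) : H.card = 2 * (H.image F).card := by
  classical
  rw [Finset.card_eq_sum_card_image F H, mul_comm, ← smul_eq_mul, ← Finset.sum_const]
  refine Finset.sum_congr rfl fun x hx => ?_
  obtain ⟨h, hh, rfl⟩ := Finset.mem_image.1 hx
  have hfiber : {k ∈ H | F k = F h} = {h, m h} := by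
    ext k
    simp only [Finset.mem_filter, Finset.mem_insert, Finset.mem_singleton]
    refine ⟨fun hk => (hF h hh k hk.1).1 hk.2, fun hk => ?_⟩
    have hkH : k ∈ H := by rcases hk with rfl | rfl; exacts [hh, hmem h hh]
    exact ⟨hkH, (hF h hh k hkH).2 hk⟩
  rw [hfiber, Finset.card_pair (hne h hh).symm]

end FiniteIdentification

section SphereArea

instance : IsFiniteMeasure sphereArea :=
  inferInstanceAs (IsFiniteMeasure (volume : Measure R3).toSphere)

theorem sphereArea_real_univ : sphereArea.real univ = 4 * Real.pi := by
  rw [measureReal_def, sphereArea, Measure.toSphere_apply_univ,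
    EuclideanSpace.volume_ball_fin_three, ENNReal.toReal_mul, ENNReal.toReal_mul]
  simp only [finrank_euclideanSpace, Fintype.card_fin, ENNReal.ofReal_one, one_pow,
    ENNReal.toReal_one, ENNReal.toReal_natCast,
    ENNReal.toReal_ofReal (by positivity : 0 ≤ Real.pi * 4 / 3)]
  ring

end SphereArea

namespace PiecewiseC2Graph

variable {V E : Type*} (G : PiecewiseC2Graph V E)

section Heights

theorem hasDerivWithinAt_curve (a : E) : ∀ s ∈ Icc 0 (G.len a),
    HasDerivWithinAt (G.curve a) (G.velocity a s) (Icc 0 (G.len a)) s := fun s hs =>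
  ((G.contDiffOn_curve a).differentiableOn two_ne_zero s hs).hasDerivWithinAt

theorem hasDerivWithinAt_velocity (a : E) : ∀ s ∈ Icc 0 (G.len a),
    HasDerivWithinAt (G.velocity a) (G.curvatureVector a s) (Icc 0 (G.len a)) s := by
  intro s hs
  have hC1 : ContDiffOn ℝ 1 (G.velocity a) (Icc 0 (G.len a)) :=
    (G.contDiffOn_curve a).derivWithin (uniqueDiffOn_Icc (G.len_pos a)) (by norm_num)
  have hcurv : derivWithin (G.velocity a) (Icc 0 (G.len a)) s = G.curvatureVector a s := by
    rw [curvatureVector, iteratedDerivWithin_succ, iteratedDerivWithin_one]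
    rfl
  exact hcurv ▸ (hC1.differentiableOn one_ne_zero s hs).hasDerivWithinAt

theorem continuousOn_curvatureVector (a : E) :
    ContinuousOn (G.curvatureVector a) (Icc 0 (G.len a)) :=
  (G.contDiffOn_curve a).continuousOn_iteratedDerivWithin le_rfl
    (uniqueDiffOn_Icc (G.len_pos a))

theorem norm_endTangent (a : E) (b : Bool) : ‖G.endTangent a b‖ = 1 := by
  cases b
  · exact G.unit_speed a 0 (left_mem_Icc.2 (G.len_pos a).le)
  · exact (norm_neg _).trans (G.unit_speed a _ (right_mem_Icc.2 (G.len_pos a).le))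

/-- The height function `⟨e, ·⟩` along the edge `a`, in terms of arc length. -/
def edgeHeight (e : S2) (a : E) (s : ℝ) : ℝ := inner ℝ (e : R3) (G.curve a s)

theorem hasDerivWithinAt_edgeHeight (e : S2) (a : E) : ∀ s ∈ Icc 0 (G.len a),
    HasDerivWithinAt (G.edgeHeight e a) (inner ℝ (e : R3) (G.velocity a s)) (Icc 0 (G.len a)) s :=
  fun s hs => hasDerivWithinAt_inner_const (G.hasDerivWithinAt_curve a s hs) e

/-- The arc length parameter of an end of an edge. -/
def endParam (a : E) : Bool → ℝ
  | false => 0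
  | true => G.len a

theorem endParam_mem_Icc (a : E) (b : Bool) : G.endParam a b ∈ Icc 0 (G.len a) := by
  cases b
  exacts [left_mem_Icc.2 (G.len_pos a).le, right_mem_Icc.2 (G.len_pos a).le]

theorem isLocalMaxOn_edgeHeight_endParam_iff {e : S2} {a : E} {b : Bool}
    (hne : inner ℝ (e : R3) (G.endTangent a b) ≠ 0) :
    IsLocalMaxOn (G.edgeHeight e a) (Icc 0 (G.len a)) (G.endParam a b) ↔
      inner ℝ (e : R3) (G.endTangent a b) < 0 := by
  have hmem := G.endParam_mem_Icc a b
  have hD := uniqueDiffOn_Icc (G.len_pos a) _ hmem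
  have hderiv := G.hasDerivWithinAt_edgeHeight e a _ hmem
  cases b
  · have hdir : inner ℝ (e : R3) (G.endTangent a false) =
        1 * inner ℝ (e : R3) (G.velocity a (G.endParam a false)) := (one_mul _).symm
    rw [hdir] at hne ⊢
    exact isLocalMaxOn_iff_mul_neg hD (fun t ht => by simpa [endParam] using ht.1) hderiv hne
  · have hdir : inner ℝ (e : R3) (G.endTangent a true) =
        -1 * inner ℝ (e : R3) (G.velocity a (G.endParam a true)) := by
      rw [endTangent, inner_neg_right, neg_one_mul, endParam]
    rw [hdir] at hne ⊢
    exact isLocalMaxOn_iff_mul_neg hD (fun t ht => by simpa [endParam] using ht.2) hderiv hne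

theorem isLocalMaxOn_edgeHeight_iff_curvatureVector {e : S2} {a : E} {s : ℝ}
    (hs : s ∈ Ioo 0 (G.len a)) (hcrit : inner ℝ (e : R3) (G.velocity a s) = 0)
    (hne : inner ℝ (e : R3) (G.curvatureVector a s) ≠ 0) :
    IsLocalMaxOn (G.edgeHeight e a) (Icc 0 (G.len a)) s ↔
      inner ℝ (e : R3) (G.curvatureVector a s) < 0 := by
  have hnhds := Icc_mem_nhds hs.1 hs.2
  have hderiv : ∀ᶠ t in 𝓝 s,
      HasDerivAt (G.edgeHeight e a) (inner ℝ (e : R3) (G.velocity a t)) t := by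
    filter_upwards [Ioo_mem_nhds hs.1 hs.2] with t ht
    exact (G.hasDerivWithinAt_edgeHeight e a t (Ioo_subset_Icc_self ht)).hasDerivAt
      (Icc_mem_nhds ht.1 ht.2)
  have hderiv2 := (hasDerivWithinAt_inner_const
    (G.hasDerivWithinAt_velocity a s (Ioo_subset_Icc_self hs)) (e : R3)).hasDerivAt hnhds
  rw [← isLocalMax_iff_hasDerivAt_neg hderiv hderiv2 hcrit hne]
  exact ⟨fun h => h.isLocalMax hnhds, fun h => h.on _⟩

end Heights

section GenericDirections

/-- A direction is generic when it is orthogonal to no end tangent and the height functions along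
the edges have nondegenerate critical points only. -/
structure IsGeneric (e : S2) : Prop where
  endTangent_ne : ∀ a b, inner ℝ (e : R3) (G.endTangent a b) ≠ 0
  nondegenerate : ∀ a, ∀ s ∈ Icc 0 (G.len a),
    inner ℝ (e : R3) (G.velocity a s) = 0 → inner ℝ (e : R3) (G.curvatureVector a s) ≠ 0

variable {G} in
theorem IsGeneric.neg {e : S2} (he : G.IsGeneric e) : G.IsGeneric (-e) where
  endTangent_ne a b := by simpa using he.endTangent_ne a b
  nondegenerate a s hs := by simpa using he.nondegenerate a s hs

theorem ae_isGeneric [Finite E] : ∀ᵐ e ∂sphereArea, G.IsGeneric e := by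
  have hend : ∀ᵐ e : S2 ∂sphereArea, ∀ a b, inner ℝ (e : R3) (G.endTangent a b) ≠ 0 :=
    eventually_all.2 fun a => eventually_all.2 fun b =>
      ae_toSphere_inner_ne_zero (norm_ne_zero_iff.1 (G.norm_endTangent a b ▸ one_ne_zero))
  have hcrit : ∀ᵐ e : S2 ∂sphereArea, ∀ a, ∀ s ∈ Icc 0 (G.len a),
      inner ℝ (e : R3) (G.velocity a s) = 0 → inner ℝ (e : R3) (G.curvatureVector a s) ≠ 0 :=
    eventually_all.2 fun a => ae_toSphere_forall_inner_eq_zero_imp_ne_zero isCompact_Icc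
      (G.hasDerivWithinAt_velocity a) (G.continuousOn_curvatureVector a)
      fun s hs => norm_ne_zero_iff.1 (G.unit_speed a s hs ▸ one_ne_zero)
  filter_upwards [hend, hcrit] with e he he' using ⟨he, he'⟩

/-- The interior critical points of the height along an edge, by arc length. -/
def edgeCriticalParams (e : S2) (a : E) : Set ℝ :=
  {s ∈ Ioo 0 (G.len a) | inner ℝ (e : R3) (G.velocity a s) = 0}

/-- The nondegenerate interior local maxima of the height along an edge, by arc length. -/
def heightDescents (e : S2) (a : E) : Set ℝ :=
  hyperplaneDescents (G.velocity a) (G.curvatureVector a) 0 (G.len a) e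

theorem heightDescents_eq (e : S2) (a : E) : G.heightDescents e a =
    {s ∈ G.edgeCriticalParams e a | inner ℝ (e : R3) (G.curvatureVector a s) < 0} :=
  ext fun _ => and_assoc.symm

theorem criticalPoints_eq (e : S2) :
    G.criticalPoints e = range G.pos ∪ ⋃ a, G.curve a '' G.edgeCriticalParams e a := by
  rw [criticalPoints]
  congr 1
  ext q
  simp only [mem_ofPred_eq, mem_iUnion, mem_image, edgeCriticalParams]
  exact exists_congr fun a => exists_congr fun s => by tauto

theorem disjoint_range_pos_iUnion_image_curve (e : S2) :
    Disjoint (range G.pos) (⋃ a, G.curve a '' G.edgeCriticalParams e a) := by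
  rw [disjoint_iUnion_right]
  refine fun a => disjoint_left.2 ?_
  rintro _ ⟨v, rfl⟩ ⟨s, hs, hsv⟩
  exact G.interior_ne_vertex a s hs.1 v hsv

theorem pairwise_disjoint_image_curve (e : S2) :
    Pairwise (Function.onFun Disjoint fun a => G.curve a '' G.edgeCriticalParams e a) := by
  refine fun a b hab => disjoint_left.2 ?_
  rintro _ ⟨s, hs, rfl⟩ ⟨t, ht, hst⟩
  exact G.interior_disjoint a b hab s hs.1 t ht.1 hst.symm

variable {G} {e : S2}

theorem IsGeneric.finite_edgeCriticalParams (he : G.IsGeneric e) (a : E) :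
    (G.edgeCriticalParams e a).Finite :=
  (finite_setOf_eq_zero_of_hasDerivWithinAt isCompact_Icc
    (fun s hs => hasDerivWithinAt_inner_const (G.hasDerivWithinAt_velocity a s hs) (e : R3))
    (he.nondegenerate a)).subset fun _ h => ⟨Ioo_subset_Icc_self h.1, h.2⟩

theorem IsGeneric.finite_criticalPoints [Finite V] [Finite E] (he : G.IsGeneric e) :
    (G.criticalPoints e).Finite := by
  rw [criticalPoints_eq]
  exact (finite_range _).union (finite_iUnion fun a => (he.finite_edgeCriticalParams a).image _)

end GenericDirections

section DoubledEdges

theorem doubledEnd_eq (d : E × Bool) (b : Bool) :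
    G.doubledEnd (d, b) = ⟨d, G.endParam d.1 b, G.endParam_mem_Icc d.1 b⟩ := by
  cases b <;> rfl

theorem doubledEnd_injective : Function.Injective G.doubledEnd := by
  rintro ⟨d, b⟩ ⟨d', b'⟩ h
  obtain rfl : d = d' := by simpa [doubledEnd_eq] using congrArg Sigma.fst h
  have hparam : G.endParam d.1 b = G.endParam d.1 b' := by simpa [doubledEnd_eq] using h
  have hlen := G.len_pos d.1
  cases b <;> cases b' <;> simp_all [endParam, hlen.ne, hlen.ne']

variable {G}

theorem exists_doubledEnd_of_doubledMap_eq_pos {x : G.DoubledEdges} {v : V}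
    (hx : G.doubledMap x = G.pos v) :
    ∃ h, G.doubledEnd h = x ∧ G.endVertex h.1.1 h.2 = v := by
  obtain ⟨d, s, hs⟩ := x
  obtain ⟨b, rfl⟩ : ∃ b, s = G.endParam d.1 b := by
    by_contra! hne
    exact G.interior_ne_vertex d.1 s
      ⟨hs.1.lt_of_ne (hne false).symm, hs.2.lt_of_ne (hne true)⟩ v hx
  refine ⟨(d, b), G.doubledEnd_eq d b, G.pos_injective ?_⟩
  rw [← hx, ← doubledEnd_eq, doubledMap_doubledEnd]

theorem exists_eq_of_doubledMap_eq_curve {x : G.DoubledEdges} {a : E} {s : ℝ}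
    (hs : s ∈ Ioo 0 (G.len a)) (hx : G.doubledMap x = G.curve a s) :
    ∃ i, x = ⟨(a, i), s, Ioo_subset_Icc_self hs⟩ := by
  obtain ⟨⟨a', i⟩, t, ht⟩ := x
  have hne (b : Bool) : t ≠ G.endParam a' b := by
    rintro rfl
    refine G.interior_ne_vertex a s hs (G.endVertex a' b) (hx.symm.trans ?_)
    rw [← doubledEnd_eq G (a', i) b, doubledMap_doubledEnd]
  have ht' : t ∈ Ioo 0 (G.len a') := ⟨ht.1.lt_of_ne (hne false).symm, ht.2.lt_of_ne (hne true)⟩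
  obtain rfl : a' = a := by
    by_contra haa
    exact G.interior_disjoint a' a haa t ht' s hs hx
  obtain rfl : t = s := G.injOn_curve a' ht (Ioo_subset_Icc_self hs) hx
  exact ⟨i, rfl⟩

open Classical in
variable (G) in
/-- The ends of doubled edges at the vertex `v`. -/
def doubledEndsAt [Fintype E] (v : V) : Finset ((E × Bool) × Bool) :=
  {h | G.endVertex h.1.1 h.2 = v}

theorem mem_doubledEndsAt [Fintype E] {v : V} {h : (E × Bool) × Bool} :
    h ∈ G.doubledEndsAt v ↔ G.endVertex h.1.1 h.2 = v := by
  simp [doubledEndsAt]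

open Classical in
theorem sum_doubledEndsAt [Fintype E] (v : V) (f : E × Bool → ℝ) :
    ∑ h ∈ G.doubledEndsAt v, f (h.1.1, h.2) =
      2 * ∑ h : E × Bool with G.endVertex h.1 h.2 = v, f h := by
  simp only [doubledEndsAt, Finset.sum_filter, Fintype.sum_prod_type, Fintype.sum_bool,
    Finset.mul_sum]
  exact Finset.sum_congr rfl fun a _ => by ring

end DoubledEdges

section HemisphereSign

theorem ite_sub_ite_eq_hemisphereSign_add_div_two {T U : R3} {e : S2}
    (hT : inner ℝ (e : R3) T ≠ 0) (hU : inner ℝ (e : R3) U ≠ 0) :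
    ((if inner ℝ (e : R3) T < 0 ∧ inner ℝ (e : R3) U < 0 then 1 else 0) -
      if 0 < inner ℝ (e : R3) T ∧ 0 < inner ℝ (e : R3) U then 1 else 0 : ℝ) =
      (hemisphereSign T e + hemisphereSign U e) / 2 := by
  unfold hemisphereSign
  rcases lt_or_gt_of_ne hT with h | h <;> rcases lt_or_gt_of_ne hU with h' | h' <;>
    norm_num [h, h', h.not_gt, h'.not_gt]

theorem integrable_hemisphereSign (T : R3) : Integrable (hemisphereSign T) sphereArea := by
  have hmeas : Measurable (hemisphereSign T) :=
    Measurable.ite (measurableSet_lt measurable_const (by fun_prop)) measurable_const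
      measurable_const
  refine Integrable.of_bound hmeas.aestronglyMeasurable 1 (.of_forall fun e => ?_)
  rw [hemisphereSign]
  split_ifs <;> simp

open Classical in
/-- The sum of the functions `χᵢ` of the edge ends at the vertex `v`, whose positive part is the
integrand of `vertexNetCurvature`. -/
def hemisphereSignSum [Fintype E] (v : V) (e : S2) : ℝ :=
  ∑ h : E × Bool with G.endVertex h.1 h.2 = v, hemisphereSign (G.endTangent h.1 h.2) e

theorem integrable_max_half_hemisphereSignSum [Fintype E] (v : V) :
    Integrable (fun e => max ((1 / 2) * G.hemisphereSignSum v e) 0) sphereArea :=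
  ((integrable_finsetSum _ fun _ _ => integrable_hemisphereSign _).const_mul _).pos_part

theorem integral_max_half_hemisphereSignSum [Fintype E] (v : V) :
    ∫ e, max ((1 / 2) * G.hemisphereSignSum v e) 0 ∂sphereArea = 2 * G.vertexNetCurvature v := by
  have hhalf (e : S2) : max ((1 / 2) * G.hemisphereSignSum v e) 0 =
      (1 / 2) * max (G.hemisphereSignSum v e) 0 := by
    rw [mul_max_of_nonneg _ _ one_half_pos.le, mul_zero]
  rw [integral_congr_ae (.of_forall hhalf), integral_const_mul, vertexNetCurvature]
  simp only [hemisphereSignSum]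
  ring

end HemisphereSign

section HeightDescents

theorem integrable_ncard_heightDescents (a : E) :
    Integrable (fun e => ((G.heightDescents e a).ncard : ℝ)) sphereArea :=
  integrable_ncard_hyperplaneDescents (G.len_pos a).le (G.hasDerivWithinAt_velocity a)
    (G.continuousOn_curvatureVector a) (G.unit_speed a) (by simp)

theorem integral_ncard_heightDescents (a : E) :
    ∫ e, ((G.heightDescents e a).ncard : ℝ) ∂sphereArea =
      2 * ∫ s in Ioo 0 (G.len a), ‖G.curvatureVector a s‖ := by
  have hCrofton := integral_ncard_hyperplaneDescents (G.len_pos a).le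
    (G.hasDerivWithinAt_velocity a) (G.continuousOn_curvatureVector a) (G.unit_speed a) (by simp)
  have harea : (volume : Measure R3).toSphere.real univ = 4 * Real.pi := sphereArea_real_univ
  rw [harea, intervalIntegral.integral_of_le (G.len_pos a).le, integral_Ioc_eq_integral_Ioo]
    at hCrofton
  rw [sphereArea]
  refine hCrofton.trans ?_
  field_simp
  norm_num

end HeightDescents

namespace Parameterization

variable {G} (P : G.Parameterization)

section Domain

/-- The point of the parameterizing manifold given by a point of a doubled edge. -/
def proj (x : G.DoubledEdges) : P.Domain := Quot.mk P.Glue x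

theorem proj_surjective : Function.Surjective P.proj := Quot.exists_rep

theorem isQuotientMap_proj : IsQuotientMap P.proj := isQuotientMap_quot_mk

theorem Glue.symm {P : G.Parameterization} {x y : G.DoubledEdges} (h : P.Glue x y) :
    P.Glue y x := by
  obtain ⟨k, rfl, rfl⟩ := h
  exact ⟨P.mate k, rfl, by rw [P.mate_involutive]⟩

theorem glue_doubledEnd_iff {h : (E × Bool) × Bool} {y : G.DoubledEdges} :
    P.Glue (G.doubledEnd h) y ↔ y = G.doubledEnd (P.mate h) := by
  refine ⟨?_, fun hy => ⟨h, rfl, hy⟩⟩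
  rintro ⟨k, hk, rfl⟩
  rw [G.doubledEnd_injective hk]

theorem proj_eq_proj_iff {x y : G.DoubledEdges} : P.proj x = P.proj y ↔ x = y ∨ P.Glue x y := by
  have hequiv : Equivalence fun x y => x = y ∨ P.Glue x y := by
    refine ⟨fun x => .inl rfl, Or.imp Eq.symm Glue.symm, ?_⟩
    rintro x y z (rfl | ⟨h, rfl, rfl⟩) hyz
    · exact hyz
    · rcases hyz with rfl | hyz
      · exact .inr ⟨h, rfl, rfl⟩
      · rw [glue_doubledEnd_iff, P.mate_involutive] at hyz
        exact .inl hyz.symm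
  refine ⟨fun h => ?_, fun h => h.elim (congrArg _) (Quot.sound ·)⟩
  exact hequiv.eqvGen_iff.1 ((Quot.eqvGen_exact h).mono fun _ _ => .inr)

theorem proj_doubledEnd_eq_iff {h : (E × Bool) × Bool} {y : G.DoubledEdges} :
    P.proj y = P.proj (G.doubledEnd h) ↔ y = G.doubledEnd h ∨ y = G.doubledEnd (P.mate h) := by
  rw [eq_comm, proj_eq_proj_iff, glue_doubledEnd_iff, @eq_comm _ y (G.doubledEnd h)]

theorem proj_interior_eq_iff {a : E} {i : Bool} {s : ℝ} (hs : s ∈ Ioo 0 (G.len a))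
    {y : G.DoubledEdges} :
    P.proj y = P.proj ⟨(a, i), s, Ioo_subset_Icc_self hs⟩ ↔
      y = ⟨(a, i), s, Ioo_subset_Icc_self hs⟩ := by
  rw [proj_eq_proj_iff, or_iff_left]
  rintro ⟨h, -, hk⟩
  exact G.interior_ne_vertex a s hs _
    ((congrArg G.doubledMap hk).trans (G.doubledMap_doubledEnd _))

theorem isClosedMap_proj [Finite E] : IsClosedMap P.proj := by
  refine isClosedMap_of_isQuotientMap_of_finite P.isQuotientMap_proj
    (finite_range G.doubledEnd) fun x y hxy => (P.proj_eq_proj_iff.1 hxy).imp_right ?_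
  rintro ⟨h, -, rfl⟩
  exact mem_range_self _

theorem isLocalMax_height_comp_proj_iff {e : S2} {x : G.DoubledEdges} :
    IsLocalMax (P.height e ∘ P.proj) x ↔
      IsLocalMaxOn (G.edgeHeight e x.1.1) (Icc 0 (G.len x.1.1)) x.2 := by
  obtain ⟨d, s⟩ := x
  rw [IsLocalMax, IsMaxFilter, Sigma.nhds_mk, eventually_map, IsLocalMaxOn, IsMaxFilter,
    ← map_nhds_subtype_val, eventually_map]
  rfl

theorem isLocalMax_height_proj_iff [Finite E] {e : S2} {x : G.DoubledEdges} :
    IsLocalMax (P.height e) (P.proj x) ↔ ∀ y, P.proj y = P.proj x →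
      IsLocalMaxOn (G.edgeHeight e y.1.1) (Icc 0 (G.len y.1.1)) y.2 := by
  simp only [isLocalMax_iff_forall_isLocalMax_comp P.isQuotientMap_proj.continuous
    P.isClosedMap_proj P.proj_surjective, isLocalMax_height_comp_proj_iff]

theorem height_neg (e : S2) : P.height (-e) = fun x => -P.height e x :=
  funext fun _ => inner_neg_left _ _

theorem lmin_eq_lmax_neg (e : S2) (q : R3) : P.lmin e q = P.lmax (-e) q := by
  have hneg (x : P.Domain) : IsLocalMin (P.height e) x ↔ IsLocalMax (P.height (-e)) x := by
    rw [height_neg]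
    exact ⟨fun h => h.neg, fun h => by simpa using h.neg⟩
  simp only [lmin, lmax, hneg]

end Domain

section Vertices

theorem isLocalMax_height_doubledEnd_iff [Finite E] {e : S2} (he : G.IsGeneric e)
    (h : (E × Bool) × Bool) :
    IsLocalMax (P.height e) (P.proj (G.doubledEnd h)) ↔
      inner ℝ (e : R3) (G.endTangent h.1.1 h.2) < 0 ∧
        inner ℝ (e : R3) (G.endTangent (P.mate h).1.1 (P.mate h).2) < 0 := by
  have hend (k : (E × Bool) × Bool) :
      IsLocalMaxOn (G.edgeHeight e (G.doubledEnd k).1.1) (Icc 0 (G.len (G.doubledEnd k).1.1))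
        (G.doubledEnd k).2 ↔ inner ℝ (e : R3) (G.endTangent k.1.1 k.2) < 0 := by
    rw [← G.isLocalMaxOn_edgeHeight_endParam_iff (he.endTangent_ne _ _), ← Prod.mk.eta (p := k),
      doubledEnd_eq]
  simp only [isLocalMax_height_proj_iff, proj_doubledEnd_eq_iff, forall_eq_or_imp, forall_eq, hend]

theorem mate_mem_doubledEndsAt [Fintype E] {v : V} {h : (E × Bool) × Bool} :
    P.mate h ∈ G.doubledEndsAt v ↔ h ∈ G.doubledEndsAt v := by
  rw [mem_doubledEndsAt, mem_doubledEndsAt, P.endVertex_mate]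

open Classical in
theorem two_mul_lmax_pos [Fintype E] {e : S2} (he : G.IsGeneric e) (v : V) :
    2 * P.lmax e (G.pos v) =
      {h ∈ G.doubledEndsAt v | inner ℝ (e : R3) (G.endTangent h.1.1 h.2) < 0 ∧
        inner ℝ (e : R3) (G.endTangent (P.mate h).1.1 (P.mate h).2) < 0}.card := by
  set H : Finset ((E × Bool) × Bool) :=
    {h ∈ G.doubledEndsAt v | inner ℝ (e : R3) (G.endTangent h.1.1 h.2) < 0 ∧
      inner ℝ (e : R3) (G.endTangent (P.mate h).1.1 (P.mate h).2) < 0} with hH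
  have hmem (h) : h ∈ H ↔
      h ∈ G.doubledEndsAt v ∧ IsLocalMax (P.height e) (P.proj (G.doubledEnd h)) := by
    rw [hH, Finset.mem_filter, P.isLocalMax_height_doubledEnd_iff he]
  have himage : {x | P.toSpace x = G.pos v ∧ IsLocalMax (P.height e) x} =
      (H.image (P.proj ∘ G.doubledEnd) : Finset P.Domain) := by
    ext x
    simp only [mem_ofPred_eq, Finset.coe_image, mem_image, Finset.mem_coe, hmem,
      Function.comp_apply, mem_doubledEndsAt]
    constructor
    · rintro ⟨hx, hmax⟩
      obtain ⟨y, rfl⟩ := P.proj_surjective x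
      obtain ⟨h, rfl, hv⟩ := exists_doubledEnd_of_doubledMap_eq_pos hx
      exact ⟨h, ⟨hv, hmax⟩, rfl⟩
    · rintro ⟨h, ⟨rfl, hmax⟩, rfl⟩
      exact ⟨G.doubledMap_doubledEnd h, hmax⟩
  have hcard : H.card = 2 * (H.image (P.proj ∘ G.doubledEnd)).card := by
    refine card_eq_two_mul_card_image_of_involutive (m := P.mate) (fun h _ => P.mate_ne h)
      (fun h hh => ?_) fun h _ k _ => ?_
    · rw [hH, Finset.mem_filter, mate_mem_doubledEndsAt, P.mate_involutive]
      exact (Finset.mem_filter.1 hh).imp_right And.symm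
    · simp only [Function.comp_apply, proj_doubledEnd_eq_iff, G.doubledEnd_injective.eq_iff]
  rw [lmax, himage, ncard_coe_finset, hcard]

theorem sum_doubledEndsAt_mate [Fintype E] (v : V) (f : (E × Bool) × Bool → ℝ) :
    ∑ h ∈ G.doubledEndsAt v, f (P.mate h) = ∑ h ∈ G.doubledEndsAt v, f h :=
  Finset.sum_bijective P.mate P.mate_involutive.bijective
    (fun _ => P.mate_mem_doubledEndsAt.symm) fun _ _ => rfl

theorem nlm_pos [Fintype E] {e : S2} (he : G.IsGeneric e) (v : V) :
    P.nlm e (G.pos v) = (1 / 2) * G.hemisphereSignSum v e := by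
  set χ : (E × Bool) × Bool → ℝ := fun h => hemisphereSign (G.endTangent h.1.1 h.2) e
  have hdiff : 2 * (P.lmax e (G.pos v) : ℝ) - 2 * P.lmin e (G.pos v) =
      ∑ h ∈ G.doubledEndsAt v, (χ h + χ (P.mate h)) / 2 := by
    have hmax := congrArg (Nat.cast (R := ℝ)) (P.two_mul_lmax_pos he v)
    have hmin := congrArg (Nat.cast (R := ℝ)) (P.two_mul_lmax_pos he.neg v)
    simp only [Finset.natCast_card_filter, Nat.cast_mul, Nat.cast_ofNat, coe_neg_sphere,
      inner_neg_left, neg_lt_zero] at hmax hmin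
    rw [lmin_eq_lmax_neg, hmax, hmin, ← Finset.sum_sub_distrib]
    exact Finset.sum_congr rfl fun h _ => ite_sub_ite_eq_hemisphereSign_add_div_two
      (he.endTangent_ne _ _) (he.endTangent_ne _ _)
  have hsum : ∑ h ∈ G.doubledEndsAt v, (χ h + χ (P.mate h)) / 2 =
      2 * G.hemisphereSignSum v e := by
    rw [← Finset.sum_div, Finset.sum_add_distrib, P.sum_doubledEndsAt_mate v χ, hemisphereSignSum,
      ← sum_doubledEndsAt v fun h => hemisphereSign (G.endTangent h.1 h.2) e]
    exact add_self_div_two _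
  rw [nlm]
  linarith

end Vertices

section EdgeInteriors

theorem toSpace_eq_curve_iff {a : E} {s : ℝ} (hs : s ∈ Ioo 0 (G.len a)) {x : P.Domain} :
    P.toSpace x = G.curve a s ↔ ∃ i, P.proj ⟨(a, i), s, Ioo_subset_Icc_self hs⟩ = x := by
  constructor
  · intro hx
    obtain ⟨y, rfl⟩ := P.proj_surjective x
    obtain ⟨i, rfl⟩ := exists_eq_of_doubledMap_eq_curve hs hx
    exact ⟨i, rfl⟩
  · rintro ⟨i, rfl⟩
    rfl

theorem lmax_curve [Finite E] {e : S2} (he : G.IsGeneric e) {a : E} {s : ℝ}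
    (hs : s ∈ G.edgeCriticalParams e a) : P.lmax e (G.curve a s) =
      if inner ℝ (e : R3) (G.curvatureVector a s) < 0 then 2 else 0 := by
  have hmax (i : Bool) :
      IsLocalMax (P.height e) (P.proj ⟨(a, i), s, Ioo_subset_Icc_self hs.1⟩) ↔
        inner ℝ (e : R3) (G.curvatureVector a s) < 0 := by
    simp only [isLocalMax_height_proj_iff, P.proj_interior_eq_iff hs.1, forall_eq]
    exact G.isLocalMaxOn_edgeHeight_iff_curvatureVector hs.1 hs.2
      (he.nondegenerate a s (Ioo_subset_Icc_self hs.1) hs.2)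
  have hset : {x | P.toSpace x = G.curve a s ∧ IsLocalMax (P.height e) x} =
      {x ∈ range fun i => P.proj ⟨(a, i), s, Ioo_subset_Icc_self hs.1⟩ |
        inner ℝ (e : R3) (G.curvatureVector a s) < 0} := by
    ext x
    simp only [mem_ofPred_eq, P.toSpace_eq_curve_iff hs.1, mem_range]
    refine and_congr_right ?_
    rintro ⟨i, rfl⟩
    exact hmax i
  have hinj : Function.Injective fun i => P.proj ⟨(a, i), s, Ioo_subset_Icc_self hs.1⟩ := by
    intro i j hij
    simpa [P.proj_interior_eq_iff hs.1] using hij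
  rw [lmax, hset]
  split_ifs with hneg
  · simp only [hneg, and_true, ofPred_mem_eq, ncard_range_of_injective hinj,
      Nat.card_eq_fintype_card, Fintype.card_bool]
  · simp [hneg]

theorem max_nlm_curve [Finite E] {e : S2} (he : G.IsGeneric e) {a : E} {s : ℝ}
    (hs : s ∈ G.edgeCriticalParams e a) : max (P.nlm e (G.curve a s)) 0 =
      if inner ℝ (e : R3) (G.curvatureVector a s) < 0 then 1 else 0 := by
  have hs' : s ∈ G.edgeCriticalParams (-e) a := ⟨hs.1, by simpa using hs.2⟩
  have hne := he.nondegenerate a s (Ioo_subset_Icc_self hs.1) hs.2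
  rw [nlm, lmin_eq_lmax_neg, P.lmax_curve he hs, P.lmax_curve he.neg hs']
  rcases lt_or_gt_of_ne hne with h | h <;> norm_num [h, h.not_gt]

theorem finsum_edgeCriticalParams [Finite E] {e : S2} (he : G.IsGeneric e) (a : E) :
    ∑ᶠ s ∈ G.edgeCriticalParams e a, max (P.nlm e (G.curve a s)) 0 =
      (G.heightDescents e a).ncard := by
  classical
  have hfin := he.finite_edgeCriticalParams a
  rw [finsum_mem_congr rfl fun s hs => P.max_nlm_curve he hs,
    finsum_mem_eq_finite_toFinset_sum _ hfin, Finset.sum_boole, heightDescents_eq,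
    ← ncard_coe_finset, Finset.coe_filter]
  simp only [Finite.mem_toFinset]

end EdgeInteriors

section Multiplicity

theorem multiplicity_eq [Fintype V] [Fintype E] {e : S2} (he : G.IsGeneric e) :
    P.multiplicity e = ∑ v, max ((1 / 2) * G.hemisphereSignSum v e) 0 +
      ∑ a, ((G.heightDescents e a).ncard : ℝ) := by
  have hfin (a : E) : (G.curve a '' G.edgeCriticalParams e a).Finite :=
    (he.finite_edgeCriticalParams a).image _
  have hinj (a : E) : InjOn (G.curve a) (G.edgeCriticalParams e a) :=
    (G.injOn_curve a).mono fun s hs => Ioo_subset_Icc_self hs.1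
  rw [multiplicity, criticalPoints_eq,
    finsum_mem_union (G.disjoint_range_pos_iUnion_image_curve e) (finite_range _)
      (finite_iUnion hfin),
    finsum_mem_range G.pos_injective, finsum_mem_iUnion (G.pairwise_disjoint_image_curve e) hfin,
    finsum_eq_sum_of_fintype, finsum_eq_sum_of_fintype]
  simp only [P.nlm_pos he, finsum_mem_image (hinj _), P.finsum_edgeCriticalParams he]

end Multiplicity

end Parameterization

end PiecewiseC2Graph

end

/-- For a piecewise `C²` graph and any parameterization of its double, the multiplicity is a
well-defined finite sum for almost every direction, it is integrable, and the net total curvature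
is half of its integral over the sphere. -/
theorem theorem1 {V E : Type*} [Fintype V] [Fintype E] (G : PiecewiseC2Graph V E)
    (P : G.Parameterization) :
    (∀ᵐ e ∂sphereArea, (G.criticalPoints e).Finite) ∧
      Integrable P.multiplicity sphereArea ∧
      G.netTotalCurvature = (1 / 2) * ∫ e, P.multiplicity e ∂sphereArea := by
  have hmult : P.multiplicity =ᵐ[sphereArea] fun e =>
      ∑ v, max ((1 / 2) * G.hemisphereSignSum v e) 0 + ∑ a, ((G.heightDescents e a).ncard : ℝ) :=
    G.ae_isGeneric.mono fun e he => P.multiplicity_eq he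
  have hvert := integrable_finsetSum Finset.univ fun v _ =>
    G.integrable_max_half_hemisphereSignSum v
  have hedge := integrable_finsetSum Finset.univ fun a _ => G.integrable_ncard_heightDescents a
  refine ⟨G.ae_isGeneric.mono fun e he => he.finite_criticalPoints,
    (hvert.add hedge).congr hmult.symm, ?_⟩
  rw [integral_congr_ae hmult, integral_add hvert hedge,
    integral_finsetSum _ fun v _ => G.integrable_max_half_hemisphereSignSum v,
    integral_finsetSum _ fun a _ => G.integrable_ncard_heightDescents a]
  simp only [G.integral_max_half_hemisphereSignSum, G.integral_ncard_heightDescents,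
    ← Finset.mul_sum, PiecewiseC2Graph.netTotalCurvature]
  ring
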